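/- All algebras are unital associative algebras over $\mathbb{C}$, and $B$ is such an algebra. A \emph{$B$-$B$-non-commutative probability space} is a triple $(\mathcal{A},E,\varepsilon)$, where $\mathcal{A}$ is a unital algebra, $\varepsilon:B\otimes B^{\mathrm{op}}\to\mathcal{A}$ is a unital homomorphism that is injective on $B\otimes 1$ and on $1\otimes B^{\mathrm{op}}$, and $E:\mathcal{A}\to B$ is linear with $E(1)=1$, $E(L_{b_1}R_{b_2}Z)=b_1E(Z)b_2$ and $E(ZL_b)=E(ZR_b)$, where $L_b=\varepsilon(b\otimes1)$ and $R_b=\varepsilon(1\otimes b)$. Let $\mathcal{A}_\ell$ (resp. $\mathcal{A}_r$) be the commutant in $\mathcal{A}$ of all $R_b$ (resp. all $L_b$). A \emph{pair of $B$-faces} is a pair $(C,D)$ of unital subalgebras with $\varepsilon(B\otimes1)\subseteq C\subseteq\mathcal{A}_\ell$ and $\varepsilon(1\otimes B^{\mathrm{op}})\subseteq D\subseteq\mathcal{A}_r$; more generally, $C$ and $D$ may be unital algebras given with unital homomorphisms into $\mathcal{A}$ (through which they are viewed inside $\mathcal{A}$) whose images satisfy these inclusions. A \emph{$B$-$B$-bimodule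 with specified $B$-vector state} is a direct sum $\mathcal{X}=B\oplus\mathring{\mathcal{X}}$ of $B$-$B$-bimodules with the projection $p:\mathcal{X}\to B$. Let $\mathcal{L}(\mathcal{X})$ be the algebra of linear operators on $\mathcal{X}$; with $L_b\xi=b\cdot\xi$, $R_b\xi=\xi\cdot b$, $\varepsilon(b_1\otimes b_2)=L_{b_1}R_{b_2}$ and $E_{\mathcal{L}(\mathcal{X})}(Z)=p(Z1_B)$ it is a $B$-$B$-non-commutative probability space, with left and right algebras $\mathcal{L}_\ell(\mathcal{X})$, $\mathcal{L}_r(\mathcal{X})$. The free product of a family $(\mathcal{X}_k)_{k\in K}$ is $$\ast_{k}\mathcal{X}_k=B\oplus\bigoplus_{m\ge1}\ \bigoplus_{k_1\ne k_2\ne\cdots\ne k_m}\mathring{\mathcal{X}}_{k_1}\otimes_B\cdots\otimes_B\mathring{\mathcal{X}}_{k_m},$$ and $\lambda_k:\mathcal{L}_\ell(\mathcal{X}_k)\to\mathcal{L}(\ast_j\mathcal{X}_j)$, $\rho_k:\mathcal{L}_r(\mathcal{X}_k)\to\mathcal{L}(\ast_j\mathcal{X}_j)$ are the left and right regular representations: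 $\lambda_k(T)=T\otimes1$ under $\ast_j\mathcal{X}_j\cong\mathcal{X}_k\otimes_B F_k$, with $F_k$ the sum of $B$ and the summands with $k_1\ne k$, and $\rho_k(T)=1\otimes T$ under $\ast_j\mathcal{X}_j\cong F_k'\otimes_B\mathcal{X}_k$, with $F_k'$ the sum of $B$ and the summands with $k_m\neq k$. A family $\{(C_k,D_k)\}_{k\in K}$ of pairs of $B$-faces of $\mathcal{A}$ is \emph{bi-free with amalgamation over $B$} if there are $B$-$B$-bimodules with specified $B$-vector states $\mathcal{X}_k$ and unital homomorphisms $l_k:C_k\to\mathcal{L}_\ell(\mathcal{X}_k)$, $r_k:D_k\to\mathcal{L}_r(\mathcal{X}_k)$ such that $E(Z_1\cdots Z_q)=p(T_1\cdots T_q1_B)$ for every word whose letters $Z_i$ are elements of the $C_k$ and the $D_k$, where $T_i=\lambda_k(l_k(Z_i))$ if $Z_i$ is taken from $C_k$ and $T_i=\rho_k(r_k(Z_i))$ if $Z_i$ is taken from $D_k$. \textbf{Theorem.} Let $(\mathcal{A},E,\varepsilon)$ be a $B$-$B$-non-commutative probability space, and let $\{(C_k,D_k)\}_{k\in K}$ be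 a family of pairs of $B$-faces of $\mathcal{A}$ that is bi-free with amalgamation over $B$. Let $\mathcal{X}=B\oplus\mathring{\mathcal{X}}$ be any $B$-$B$-bimodule with specified $B$-vector state on which $\mathcal{A}$ is represented, that is, with a unital homomorphism $\theta:\mathcal{A}\to\mathcal{L}(\mathcal{X})$ such that $\theta(L_{b_1}R_{b_2})=L_{b_1}R_{b_2}$ and $p(\theta(Z)1_B)=E(Z)$ (such a representation always exists), and let $n\in\mathbb{N}$. Consider $M_n(\mathcal{X})=M_n(B)\oplus M_n(\mathring{\mathcal{X}})$ as an $M_n(B)$-$M_n(B)$-bimodule with specified $M_n(B)$-vector state, with the actions $[b_{ij}]\cdot[\xi_{ij}]=[\sum_m b_{im}\cdot\xi_{mj}]$ and $[\xi_{ij}]\cdot[b_{ij}]=[\sum_m\xi_{im}\cdot b_{mj}]$. Let $M_n(C_k)$ act on $M_n(\mathcal{X})$ by $[Z_{ij}][\xi_{ij}]=[\sum_m\theta(Z_{im})\xi_{mj}]$, and let $M_n(D_k^{\mathrm{op}})^{\mathrm{op}}$ act by $[Z_{ij}][\xi_{ij}]=[\sum_m\theta(Z_{mj})\xi_{im}]$.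 Then $\{(M_n(C_k),M_n(D_k^{\mathrm{op}})^{\mathrm{op}})\}_{k\in K}$ is a family of pairs of $M_n(B)$-faces in the $M_n(B)$-$M_n(B)$-non-commutative probability space $\mathcal{L}(M_n(\mathcal{X}))$, and it is bi-free with amalgamation over $M_n(B)$. -/

import Mathlib

universe u v w x y z t

namespace BiFreeProb

open scoped TensorProduct
open MulOpposite

/-! ### Bimodules with a specified vector state -/

/-- A `B`-`B`-bimodule over the unital complex algebra `B`; the right action of `b` is the action of
`op b`. -/
structure Bimod (B : Type u) [Ring B] [Algebra ℂ B] where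
  carrier : Type w
  [addCommGroup : AddCommGroup carrier]
  [moduleComplex : Module ℂ carrier]
  [moduleLeft : Module B carrier]
  [moduleRight : Module Bᵐᵒᵖ carrier]
  [smulComm : SMulCommClass B Bᵐᵒᵖ carrier]
  [towerLeft : IsScalarTower ℂ B carrier]
  [towerRight : IsScalarTower ℂ Bᵐᵒᵖ carrier]

attribute [instance] Bimod.addCommGroup Bimod.moduleComplex Bimod.moduleLeft Bimod.moduleRight
  Bimod.smulComm Bimod.towerLeft Bimod.towerRight

namespace Bimod

variable {B : Type u} [Ring B] [Algebra ℂ B]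

/-- A bimodule `X₀` determines the bimodule `B ⊕ X₀` with specified `B`-vector state: the vector
state is the first projection. -/
abbrev Total (X₀ : Bimod.{u, w} B) : Type (max u w) := B × X₀.carrier

variable (X₀ : Bimod.{u, w} B)

/-- The operators `L_b : ξ ↦ b • ξ` on `B ⊕ X₀`. -/
def L : B →ₐ[ℂ] Module.End ℂ X₀.Total := Algebra.lsmul ℂ ℂ X₀.Total

/-- The operators `R_b : ξ ↦ ξ • b` on `B ⊕ X₀`, indexed by `op b`. -/
def R : Bᵐᵒᵖ →ₐ[ℂ] Module.End ℂ X₀.Total := Algebra.lsmul ℂ ℂ X₀.Total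

@[simp] lemma L_apply (b : B) (ξ : X₀.Total) : X₀.L b ξ = b • ξ := rfl

@[simp] lemma R_apply (b : Bᵐᵒᵖ) (ξ : X₀.Total) : X₀.R b ξ = b • ξ := rfl

lemma commute_L_R (b : B) (c : Bᵐᵒᵖ) : Commute (X₀.L b) (X₀.R c) := by
  refine LinearMap.ext fun ξ => ?_
  simp only [Module.End.mul_apply, L_apply, R_apply]
  exact smul_comm b c ξ

/-- The left algebra of `𝓛(B ⊕ X₀)`: the operators commuting with all `R_b`. -/
def leftOps : Subalgebra ℂ (Module.End ℂ X₀.Total) :=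
  Subalgebra.centralizer ℂ (Set.range X₀.R)

/-- The right algebra of `𝓛(B ⊕ X₀)`: the operators commuting with all `L_b`. -/
def rightOps : Subalgebra ℂ (Module.End ℂ X₀.Total) :=
  Subalgebra.centralizer ℂ (Set.range X₀.L)

lemma L_mem_leftOps (b : B) : X₀.L b ∈ X₀.leftOps := by
  rintro _ ⟨c, rfl⟩
  exact (X₀.commute_L_R b c).symm

lemma R_mem_rightOps (b : Bᵐᵒᵖ) : X₀.R b ∈ X₀.rightOps := by
  rintro _ ⟨c, rfl⟩
  exact X₀.commute_L_R c b

lemma leftOps_smul (T : X₀.leftOps) (c : Bᵐᵒᵖ) (ξ : X₀.Total) :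
    T.1 (c • ξ) = c • T.1 ξ :=
  (LinearMap.congr_fun (T.2 (X₀.R c) ⟨c, rfl⟩) ξ).symm

lemma rightOps_smul (T : X₀.rightOps) (b : B) (ξ : X₀.Total) :
    T.1 (b • ξ) = b • T.1 ξ :=
  (LinearMap.congr_fun (T.2 (X₀.L b) ⟨b, rfl⟩) ξ).symm

/-- The expectation `Z ↦ p (Z 1_B)` of `𝓛(B ⊕ X₀)` onto `B`. -/
def expectation : Module.End ℂ X₀.Total →ₗ[ℂ] B where
  toFun Z := (Z (1, 0)).1
  map_add' _ _ := rfl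
  map_smul' _ _ := rfl

end Bimod

/-! ### `B`-`B`-non-commutative probability spaces -/

/-- A `B`-`B`-non-commutative probability space structure on the unital algebra `A`. -/
structure NCPS (B : Type u) (A : Type v) [Ring B] [Algebra ℂ B] [Ring A] [Algebra ℂ A] where
  ε : B ⊗[ℂ] Bᵐᵒᵖ →ₐ[ℂ] A
  E : A →ₗ[ℂ] B
  injective_left : Function.Injective fun b : B => ε (b ⊗ₜ 1)
  injective_right : Function.Injective fun b : B => ε (1 ⊗ₜ op b)
  E_one : E 1 = 1
  E_smul : ∀ (b₁ b₂ : B) (Z : A), E (ε (b₁ ⊗ₜ op b₂) * Z) = b₁ * E Z * b₂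
  E_right : ∀ (b : B) (Z : A), E (Z * ε (b ⊗ₜ 1)) = E (Z * ε (1 ⊗ₜ op b))

namespace NCPS

variable {B : Type u} {A : Type v} [Ring B] [Algebra ℂ B] [Ring A] [Algebra ℂ A]
  (P : NCPS B A)

/-- The left algebra `A_ℓ`. -/
def leftAlg : Subalgebra ℂ A :=
  Subalgebra.centralizer ℂ (Set.range fun b : B => P.ε (1 ⊗ₜ op b))

/-- The right algebra `A_r`. -/
def rightAlg : Subalgebra ℂ A :=
  Subalgebra.centralizer ℂ (Set.range fun b : B => P.ε (b ⊗ₜ 1))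

/-- `(C, D)` is a pair of `B`-faces:
`ε(B ⊗ 1) ⊆ C ⊆ A_ℓ` and `ε(1 ⊗ Bᵒᵖ) ⊆ D ⊆ A_r`. -/
def IsPairOfFaces (C D : Subalgebra ℂ A) : Prop :=
  ((∀ b : B, P.ε (b ⊗ₜ 1) ∈ C) ∧ C ≤ P.leftAlg) ∧
    ((∀ b : B, P.ε (1 ⊗ₜ op b) ∈ D) ∧ D ≤ P.rightAlg)

end NCPS

/-- `𝓛(B ⊕ X₀)` as a `B`-`B`-non-commutative probability space: `ε(b₁ ⊗ b₂) = L_{b₁} R_{b₂}` and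
`E(Z) = p (Z 1_B)`. -/
def Bimod.ncps {B : Type u} [Ring B] [Algebra ℂ B] (X₀ : Bimod.{u, w} B) :
    NCPS B (Module.End ℂ X₀.Total) where
  ε := Algebra.TensorProduct.lift X₀.L X₀.R X₀.commute_L_R
  E := X₀.expectation
  injective_left b c h := by
    have := congrArg (fun Z : Module.End ℂ X₀.Total => (Z (1, 0)).1) h
    simpa using this
  injective_right b c h := by
    have := congrArg (fun Z : Module.End ℂ X₀.Total => (Z (1, 0)).1) h
    simpa using this
  E_one := rfl
  E_smul b₁ b₂ Z := by
    simp [Bimod.expectation, mul_assoc]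
  E_right b Z := by
    simp [Bimod.expectation]

/-! ### The reduced free product with amalgamation -/

section FreeProduct

variable {B : Type u} [Ring B] [Algebra ℂ B] {K : Type y} (X : K → Bimod.{u, w} B)

/-- The generators: the elements of `B` and those of the bimodules `X k`. -/
abbrev Gen : Type (max u w y) := B ⊕ (Σ k, (X k).carrier)

/-- The relations of the tensor ring of `⨁ k, X k` over `B`, together with `x ⊗ x' = 0` whenever
`x` and `x'` belong to the same `X k`. -/
inductive FreeProdRel : FreeAlgebra ℂ (Gen X) → FreeAlgebra ℂ (Gen X) → Prop
  | base_one : FreeProdRel (FreeAlgebra.ι ℂ (Sum.inl 1)) 1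
  | base_add (b c : B) : FreeProdRel (FreeAlgebra.ι ℂ (Sum.inl (b + c)))
      (FreeAlgebra.ι ℂ (Sum.inl b) + FreeAlgebra.ι ℂ (Sum.inl c))
  | base_mul (b c : B) : FreeProdRel (FreeAlgebra.ι ℂ (Sum.inl (b * c)))
      (FreeAlgebra.ι ℂ (Sum.inl b) * FreeAlgebra.ι ℂ (Sum.inl c))
  | base_smul (a : ℂ) (b : B) : FreeProdRel (FreeAlgebra.ι ℂ (Sum.inl (a • b)))
      (a • FreeAlgebra.ι ℂ (Sum.inl b))
  | add (k : K) (ξ η : (X k).carrier) : FreeProdRel (FreeAlgebra.ι ℂ (Sum.inr ⟨k, ξ + η⟩))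
      (FreeAlgebra.ι ℂ (Sum.inr ⟨k, ξ⟩) + FreeAlgebra.ι ℂ (Sum.inr ⟨k, η⟩))
  | smul_left (b : B) (k : K) (ξ : (X k).carrier) :
      FreeProdRel (FreeAlgebra.ι ℂ (Sum.inr ⟨k, b • ξ⟩))
        (FreeAlgebra.ι ℂ (Sum.inl b) * FreeAlgebra.ι ℂ (Sum.inr ⟨k, ξ⟩))
  | smul_right (b : B) (k : K) (ξ : (X k).carrier) :
      FreeProdRel (FreeAlgebra.ι ℂ (Sum.inr ⟨k, op b • ξ⟩))
        (FreeAlgebra.ι ℂ (Sum.inr ⟨k, ξ⟩) * FreeAlgebra.ι ℂ (Sum.inl b))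
  | same (k : K) (ξ η : (X k).carrier) :
      FreeProdRel (FreeAlgebra.ι ℂ (Sum.inr ⟨k, ξ⟩) * FreeAlgebra.ι ℂ (Sum.inr ⟨k, η⟩)) 0

/-- The free product with amalgamation over `B` of the bimodules `B ⊕ X k` with specified
`B`-vector states, that is, the `B`-`B`-bimodule
`B ⊕ ⨁ (n ≥ 1) (k₁ ≠ k₂ ≠ ⋯ ≠ kₙ), X k₁ ⊗_B X k₂ ⊗_B ⋯ ⊗_B X kₙ`.

It is realised as the tensor ring `⨁ (k₁, …, kₙ), X k₁ ⊗_B ⋯ ⊗_B X kₙ` of `⨁ k, X k` over `B`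
modulo the ideal generated by all `X k ⊗_B X k`; that ideal is the sum of the summands with two
equal neighbouring indices, so that exactly the summands above remain.  The tensor `ξ₁ ⊗ ⋯ ⊗ ξₙ`
is the product of the `ξᵢ`, and the bimodule structure is the multiplication by elements of `B`. -/
def FreeProd : Type (max u w y) := RingQuot (FreeProdRel X)

noncomputable instance : Ring (FreeProd X) := inferInstanceAs (Ring (RingQuot (FreeProdRel X)))

noncomputable instance : Algebra ℂ (FreeProd X) :=
  inferInstanceAs (Algebra ℂ (RingQuot (FreeProdRel X)))

namespace FreeProd

/-- The quotient map from the free algebra. -/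
noncomputable def mk : FreeAlgebra ℂ (Gen X) →ₐ[ℂ] FreeProd X :=
  RingQuot.mkAlgHom ℂ (FreeProdRel X)

variable {X} in
lemma mk_rel {s s' : FreeAlgebra ℂ (Gen X)} (h : FreeProdRel X s s') : mk X s = mk X s' :=
  RingQuot.mkAlgHom_rel ℂ h

/-- The inclusion of the summand `B`. -/
noncomputable def base : B →ₐ[ℂ] FreeProd X :=
  AlgHom.ofLinearMap
    { toFun := fun b => mk X (FreeAlgebra.ι ℂ (Sum.inl b))
      map_add' := fun b c => by rw [mk_rel (.base_add b c), map_add]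
      map_smul' := fun a b => by rw [mk_rel (.base_smul a b), map_smul]; rfl }
    ((mk_rel .base_one).trans (map_one _))
    (fun b c => (mk_rel (.base_mul b c)).trans (map_mul _ _ _))

variable {X} in
lemma smul_eq (k : K) (a : ℂ) (ξ : (X k).carrier) :
    mk X (FreeAlgebra.ι ℂ (Sum.inr ⟨k, a • ξ⟩)) = a • mk X (FreeAlgebra.ι ℂ (Sum.inr ⟨k, ξ⟩)) := by
  have h : a • ξ = (a • (1 : B)) • ξ := by rw [smul_assoc, one_smul]
  rw [h, mk_rel (.smul_left _ k ξ), map_mul, mk_rel (.base_smul a 1), map_smul,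
    mk_rel .base_one, map_one, smul_mul_assoc, one_mul]

/-- The inclusion of the summand `X k`. -/
noncomputable def of (k : K) : (X k).carrier →ₗ[ℂ] FreeProd X where
  toFun ξ := mk X (FreeAlgebra.ι ℂ (Sum.inr ⟨k, ξ⟩))
  map_add' ξ η := by rw [mk_rel (.add k ξ η), map_add]
  map_smul' a ξ := smul_eq k a ξ

/-- The inclusion of `B ⊕ X k`. -/
noncomputable def incl (k : K) : (X k).Total →ₗ[ℂ] FreeProd X :=
  (base X).toLinearMap.coprod (of X k)

variable {X}

lemma of_smul_left (k : K) (b : B) (ξ : (X k).carrier) :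
    of X k (b • ξ) = base X b * of X k ξ :=
  (mk_rel (.smul_left b k ξ)).trans (map_mul _ _ _)

lemma of_smul_right (k : K) (b : Bᵐᵒᵖ) (ξ : (X k).carrier) :
    of X k (b • ξ) = of X k ξ * base X b.unop :=
  (mk_rel (.smul_right b.unop k ξ)).trans (map_mul _ _ _)

lemma of_mul_of (k : K) (ξ η : (X k).carrier) : of X k ξ * of X k η = 0 := by
  have h := mk_rel (.same k ξ η)
  rwa [map_mul, map_zero] at h

lemma incl_smul_left (k : K) (b : B) (ξ : (X k).Total) :
    incl X k (b • ξ) = base X b * incl X k ξ := by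
  simp [incl, of_smul_left, mul_add]

lemma incl_smul_right (k : K) (b : Bᵐᵒᵖ) (ξ : (X k).Total) :
    incl X k (b • ξ) = incl X k ξ * base X b.unop := by
  simp [incl, of_smul_right, add_mul]

/-- The universal property of the presentation. -/
noncomputable def lift {S : Type z} [Ring S] [Algebra ℂ S] (f : B →ₐ[ℂ] S)
    (g : ∀ k, (X k).carrier → S) (hadd : ∀ k ξ η, g k (ξ + η) = g k ξ + g k η)
    (hleft : ∀ (b : B) k ξ, g k (b • ξ) = f b * g k ξ)
    (hright : ∀ (b : B) k ξ, g k (op b • ξ) = g k ξ * f b)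
    (hsame : ∀ k ξ η, g k ξ * g k η = 0) : FreeProd X →ₐ[ℂ] S :=
  RingQuot.liftAlgHom ℂ ⟨FreeAlgebra.lift ℂ (Sum.elim f fun s => g s.1 s.2), by
    intro s s' h
    induction h with
    | base_one => simp
    | base_add => simp
    | base_mul => simp
    | base_smul => simp
    | add => simp [hadd]
    | smul_left => simp [hleft]
    | smul_right => simp [hright]
    | same => simp [hsame]⟩

section
variable {S : Type z} [Ring S] [Algebra ℂ S] (f : B →ₐ[ℂ] S)
    (g : ∀ k, (X k).carrier → S) (hadd : ∀ k ξ η, g k (ξ + η) = g k ξ + g k η)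
    (hleft : ∀ (b : B) k ξ, g k (b • ξ) = f b * g k ξ)
    (hright : ∀ (b : B) k ξ, g k (op b • ξ) = g k ξ * f b)
    (hsame : ∀ k ξ η, g k ξ * g k η = 0)

@[simp] lemma lift_base (b : B) : lift f g hadd hleft hright hsame (base X b) = f b :=
  (RingQuot.liftAlgHom_mkAlgHom_apply ℂ _ _ _).trans (by simp)

@[simp] lemma lift_of (k : K) (ξ : (X k).carrier) :
    lift f g hadd hleft hright hsame (of X k ξ) = g k ξ :=
  (RingQuot.liftAlgHom_mkAlgHom_apply ℂ _ _ _).trans (by simp)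

end

@[elab_as_elim]
lemma induction {motive : FreeProd X → Prop} (base : ∀ b, motive (base X b))
    (of : ∀ k ξ, motive (of X k ξ)) (mul : ∀ a b, motive a → motive b → motive (a * b))
    (add : ∀ a b, motive a → motive b → motive (a + b)) (a : FreeProd X) : motive a := by
  obtain ⟨a, rfl⟩ : ∃ a', mk X a' = a := RingQuot.mkAlgHom_surjective ℂ (FreeProdRel X) a
  induction a using FreeAlgebra.induction with
  | grade0 c =>
    have h : mk X (algebraMap ℂ _ c) = FreeProd.base X (algebraMap ℂ B c) := by
      rw [AlgHom.commutes, AlgHom.commutes]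
    rw [h]
    exact base _
  | grade1 g =>
    rcases g with b | ⟨j, ξ⟩
    · exact base b
    · exact of j ξ
  | mul a b ha hb => rw [map_mul]; exact mul _ _ ha hb
  | add a b ha hb => rw [map_add]; exact add _ _ ha hb

variable (X) in
/-- The vector state of the free product: the projection onto the summand `B`. -/
noncomputable def proj : FreeProd X →ₐ[ℂ] B :=
  lift (AlgHom.id ℂ B) (fun _ _ => 0) (by simp) (by simp) (by simp) (by simp)

variable (X) in
/-- The expectation `Z ↦ p (Z 1_B)` on the linear operators of the free product. -/
noncomputable def expectation (Z : Module.End ℂ (FreeProd X)) : B := proj X (Z 1)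

/-! ### The left and right regular representations

Let `F_k` be the sum of `B` and the tensors that do not begin with a vector of `X k`.  The free
product is `(B ⊕ X k) ⊗_B F_k`, and `λ_k(T)` is `T ⊗ 1`, that is,
`λ_k(T) (ξ ⊗ a) = T ξ ⊗ a` for `ξ ∈ B ⊕ X k` and `a ∈ F_k`.  Reading words from the right, the free
product acts on triples that consist of an element `a`, its component in `F_k`, and the family
`T ↦ λ_k(T) a`; this defines `λ_k`.  The lemmas `leftReg_one`, `leftReg_base_mul`,
`leftReg_of_mul_of_ne`, `leftReg_of`, `leftReg_of_mul_of_mul` give its values on all tensors.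
The right regular representation `ρ_k(T) = 1 ⊗ T` is the mirror image. -/

section LeftRegular

variable (X) (k : K)

/-- The triples on which the free product acts from the left. -/
abbrev LeftState : Type (max u w y) :=
  FreeProd X × FreeProd X × ((X k).leftOps →ₗ[ℂ] FreeProd X)

/-- The family `T ↦ T ξ ⊗ a`, linear in `a`. -/
noncomputable def leftEval (ξ : (X k).Total) :
    FreeProd X →ₗ[ℂ] ((X k).leftOps →ₗ[ℂ] FreeProd X) :=
  LinearMap.mk₂ ℂ (fun a (T : (X k).leftOps) => incl X k (T.1 ξ) * a)
    (by intros; exact mul_add _ _ _) (by intros; exact mul_smul_comm _ _ _)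
    (by intros; simp [add_mul]) (by intros; simp)

variable {X k} in
@[simp] lemma leftEval_apply (ξ : (X k).Total) (a : FreeProd X) (T : (X k).leftOps) :
    leftEval X k ξ a T = incl X k (T.1 ξ) * a := rfl

/-- The action of `B`: the image of `b * a` under `λ_k(T)` is that of `a` under `λ_k(T L_b)`. -/
noncomputable def leftActBase : B →ₐ[ℂ] Module.End ℂ (LeftState X k) :=
  AlgHom.ofLinearMap
    { toFun := fun b => (LinearMap.mulLeft ℂ (base X b)).prodMap
        ((LinearMap.mulLeft ℂ (base X b)).prodMap (LinearMap.lcomp ℂ (FreeProd X)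
          (LinearMap.mulRight ℂ (⟨(X k).L b, (X k).L_mem_leftOps b⟩ : (X k).leftOps))))
      map_add' := fun b c => by
        refine LinearMap.ext fun s => Prod.ext ?_ (Prod.ext ?_ (LinearMap.ext fun T => ?_))
        · simp [add_mul]
        · simp [add_mul]
        · simp [← map_add, ← mul_add]
      map_smul' := fun a b => by
        refine LinearMap.ext fun s => Prod.ext ?_ (Prod.ext ?_ (LinearMap.ext fun T => ?_))
        · simp
        · simp
        · simp only [LinearMap.prodMap_apply, LinearMap.lcomp_apply, LinearMap.mulRight_apply,
            RingHom.id_apply, LinearMap.smul_apply, Prod.smul_snd, ← map_smul,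
            ← mul_smul_comm]
          congr 2
          exact Subtype.ext (by simp) }
    (by
      refine LinearMap.ext fun s => Prod.ext ?_ (Prod.ext ?_ (LinearMap.ext fun T => ?_))
      · simp
      · simp
      · simp only [LinearMap.coe_mk, AddHom.coe_mk, LinearMap.prodMap_apply,
          LinearMap.lcomp_apply, LinearMap.mulRight_apply, Module.End.one_apply]
        congr 1
        exact Subtype.ext (by simp))
    (fun b c => by
      refine LinearMap.ext fun s => Prod.ext ?_ (Prod.ext ?_ (LinearMap.ext fun T => ?_))
      · simp [mul_assoc]
      · simp [mul_assoc]
      · simp only [LinearMap.coe_mk, AddHom.coe_mk, LinearMap.prodMap_apply,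
          LinearMap.lcomp_apply, LinearMap.mulRight_apply, Module.End.mul_apply]
        congr 1
        exact Subtype.ext (by simp [mul_assoc]))

open Classical in
/-- The action of a vector `ξ` of `X j`. -/
noncomputable def leftActOf (j : K) (ξ : (X j).carrier) : Module.End ℂ (LeftState X k) where
  toFun s := (of X j ξ * s.1, if j = k then 0 else of X j ξ * s.1,
    if h : j = k then leftEval X k (0, h ▸ ξ) s.2.1 else leftEval X k (1, 0) (of X j ξ * s.1))
  map_add' s s' := by
    by_cases h : j = k <;> simp [h, mul_add]
  map_smul' a s := by
    by_cases h : j = k <;> simp [h]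

/-- The left action of the free product on the triples. -/
noncomputable def leftAct : FreeProd X →ₐ[ℂ] Module.End ℂ (LeftState X k) :=
  lift (leftActBase X k) (leftActOf X k)
    (fun j ξ η => by
      refine LinearMap.ext fun s => ?_
      by_cases h : j = k
      · subst h
        refine Prod.ext ?_ (Prod.ext ?_ (LinearMap.ext fun T => ?_))
        · simp [leftActOf, add_mul]
        · simp [leftActOf]
        · have e : ((0, ξ + η) : (X j).Total) = (0, ξ) + (0, η) := by simp
          simp only [leftActOf, LinearMap.coe_mk, AddHom.coe_mk, dite_true, leftEval_apply, e,
            map_add, add_mul, LinearMap.add_apply, Prod.snd_add]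
      · refine Prod.ext ?_ (Prod.ext ?_ (LinearMap.ext fun T => ?_)) <;>
          simp [leftActOf, h, add_mul, mul_add])
    (fun b j ξ => by
      refine LinearMap.ext fun s => ?_
      by_cases h : j = k
      · subst h
        refine Prod.ext ?_ (Prod.ext ?_ (LinearMap.ext fun T => ?_))
        · simp [leftActOf, leftActBase, of_smul_left, mul_assoc]
        · simp [leftActOf, leftActBase]
        · simp [leftActOf, leftActBase]
      · refine Prod.ext ?_ (Prod.ext ?_ (LinearMap.ext fun T => ?_))
        · simp [leftActOf, leftActBase, of_smul_left, mul_assoc]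
        · simp [leftActOf, leftActBase, h, of_smul_left, mul_assoc]
        · have e : (b • (1, 0) : (X k).Total) = op b • ((1, 0) : (X k).Total) := by simp
          simp only [leftActOf, leftActBase, h, of_smul_left, LinearMap.coe_mk, AddHom.coe_mk,
            dite_false, leftEval_apply, AlgHom.ofLinearMap_apply, Module.End.mul_apply,
            LinearMap.prodMap_apply, LinearMap.lcomp_apply, LinearMap.mulRight_apply,
            Subalgebra.coe_mul, Bimod.L_apply, e, (X k).leftOps_smul, incl_smul_right,
            unop_op, mul_assoc])
    (fun b j ξ => by
      refine LinearMap.ext fun s => ?_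
      by_cases h : j = k
      · subst h
        refine Prod.ext ?_ (Prod.ext ?_ (LinearMap.ext fun T => ?_))
        · simp [leftActOf, leftActBase, of_smul_right, mul_assoc]
        · simp [leftActOf, leftActBase]
        · have e : ((0, op b • ξ) : (X j).Total) = op b • ((0, ξ) : (X j).Total) := by simp
          simp [leftActOf, leftActBase, e, (X j).leftOps_smul, incl_smul_right, mul_assoc,
            -Prod.smul_mk]
      · refine Prod.ext ?_ (Prod.ext ?_ (LinearMap.ext fun T => ?_)) <;>
          simp [leftActOf, leftActBase, h, of_smul_right, mul_assoc])
    (fun j ξ η => by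
      refine LinearMap.ext fun s => ?_
      by_cases h : j = k
      · subst h
        refine Prod.ext ?_ (Prod.ext ?_ (LinearMap.ext fun T => ?_)) <;>
          simp [leftActOf, ← mul_assoc, of_mul_of]
      · refine Prod.ext ?_ (Prod.ext ?_ (LinearMap.ext fun T => ?_)) <;>
          simp [leftActOf, h, ← mul_assoc, of_mul_of])

@[simp] lemma leftAct_base (b : B) : leftAct X k (base X b) = leftActBase X k b :=
  lift_base ..

@[simp] lemma leftAct_of (j : K) (ξ : (X j).carrier) :
    leftAct X k (of X j ξ) = leftActOf X k j ξ :=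
  lift_of ..

/-- The left regular representation `λ_k : 𝓛_ℓ(B ⊕ X k) → 𝓛(B ⊕ ⨁ ⋯)`. -/
noncomputable def leftReg (T : (X k).leftOps) : Module.End ℂ (FreeProd X) where
  toFun a := (leftAct X k a (1, 1, leftEval X k (1, 0) 1)).2.2 T
  map_add' a a' := by simp
  map_smul' c a := by simp

variable {X k}

lemma leftReg_one (T : (X k).leftOps) : leftReg X k T 1 = incl X k (T.1 (1, 0)) := by
  simp [leftReg]

lemma leftReg_base_mul (T : (X k).leftOps) (b : B) (a : FreeProd X) :
    leftReg X k T (base X b * a) =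
      leftReg X k (T * ⟨(X k).L b, (X k).L_mem_leftOps b⟩) a := by
  simp [leftReg, leftActBase]

lemma leftAct_fst (a : FreeProd X) (s : LeftState X k) : (leftAct X k a s).1 = a * s.1 := by
  induction a using FreeProd.induction generalizing s with
  | base b => simp [leftActBase]
  | of j ξ => simp [leftActOf]
  | mul a b ha hb => rw [map_mul, Module.End.mul_apply, ha, hb, mul_assoc]
  | add a b ha hb => rw [map_add, LinearMap.add_apply, Prod.fst_add, ha, hb, add_mul]

/-- On tensors that begin with a vector of `X j`, `j ≠ k`. -/
lemma leftReg_of_mul_of_ne {j : K} (h : j ≠ k) (T : (X k).leftOps) (ξ : (X j).carrier)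
    (a : FreeProd X) :
    leftReg X k T (of X j ξ * a) = incl X k (T.1 (1, 0)) * (of X j ξ * a) := by
  have h1 := leftAct_fst (k := k) a (1, 1, leftEval X k (1, 0) 1)
  simp only [mul_one] at h1
  simp only [leftReg, LinearMap.coe_mk, AddHom.coe_mk, map_mul, Module.End.mul_apply]
  simp [leftActOf, h, h1]

/-- On the vectors of `X k`. -/
lemma leftReg_of (T : (X k).leftOps) (ξ : (X k).carrier) :
    leftReg X k T (of X k ξ) = incl X k (T.1 (0, ξ)) := by
  simp [leftReg, leftActOf]

/-- On tensors that begin with a vector of `X k` followed by a vector of `X j`, `j ≠ k`. -/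
lemma leftReg_of_mul_of_mul {j : K} (h : j ≠ k) (T : (X k).leftOps) (ξ : (X k).carrier)
    (η : (X j).carrier) (a : FreeProd X) :
    leftReg X k T (of X k ξ * (of X j η * a)) = incl X k (T.1 (0, ξ)) * (of X j η * a) := by
  have h1 := leftAct_fst (k := k) a (1, 1, leftEval X k (1, 0) 1)
  simp only [mul_one] at h1
  simp only [leftReg, LinearMap.coe_mk, AddHom.coe_mk, map_mul, Module.End.mul_apply]
  simp [leftActOf, h, h1]

end LeftRegular

section RightRegular

variable (X) (k : K)

/-- The triples on which the free product acts from the right. -/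
abbrev RightState : Type (max u w y) :=
  FreeProd X × FreeProd X × ((X k).rightOps →ₗ[ℂ] FreeProd X)

/-- The family `T ↦ a ⊗ T ξ`, linear in `a`. -/
noncomputable def rightEval (ξ : (X k).Total) :
    FreeProd X →ₗ[ℂ] ((X k).rightOps →ₗ[ℂ] FreeProd X) :=
  LinearMap.mk₂ ℂ (fun a (T : (X k).rightOps) => a * incl X k (T.1 ξ))
    (by intros; exact add_mul _ _ _) (by intros; exact smul_mul_assoc _ _ _)
    (by intros; simp [mul_add]) (by intros; simp)

variable {X k} in
@[simp] lemma rightEval_apply (ξ : (X k).Total) (a : FreeProd X) (T : (X k).rightOps) :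
    rightEval X k ξ a T = a * incl X k (T.1 ξ) := rfl

/-- The action of `B`: the image of `a * b` under `ρ_k(T)` is that of `a` under `ρ_k(T R_b)`. -/
noncomputable def rightActBase : B →ₐ[ℂ] (Module.End ℂ (RightState X k))ᵐᵒᵖ :=
  AlgHom.ofLinearMap
    { toFun := fun b => op ((LinearMap.mulRight ℂ (base X b)).prodMap
        ((LinearMap.mulRight ℂ (base X b)).prodMap (LinearMap.lcomp ℂ (FreeProd X)
          (LinearMap.mulRight ℂ
            (⟨(X k).R (op b), (X k).R_mem_rightOps (op b)⟩ : (X k).rightOps)))))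
      map_add' := fun b c => by
        refine unop_injective <|
          LinearMap.ext fun s => Prod.ext ?_ (Prod.ext ?_ (LinearMap.ext fun T => ?_))
        · simp [mul_add]
        · simp [mul_add]
        · simp [← map_add, ← mul_add]
      map_smul' := fun a b => by
        refine unop_injective <|
          LinearMap.ext fun s => Prod.ext ?_ (Prod.ext ?_ (LinearMap.ext fun T => ?_))
        · simp
        · simp
        · simp only [LinearMap.prodMap_apply, LinearMap.lcomp_apply, LinearMap.mulRight_apply,
            RingHom.id_apply, LinearMap.smul_apply, Prod.smul_snd, ← map_smul,
            ← mul_smul_comm, unop_smul, unop_op]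
          congr 2
          exact Subtype.ext (by simp) }
    (by
      refine unop_injective <|
        LinearMap.ext fun s => Prod.ext ?_ (Prod.ext ?_ (LinearMap.ext fun T => ?_))
      · simp
      · simp
      · simp only [LinearMap.coe_mk, AddHom.coe_mk, LinearMap.prodMap_apply,
          LinearMap.lcomp_apply, LinearMap.mulRight_apply, Module.End.one_apply, unop_op,
          unop_one]
        congr 1
        exact Subtype.ext (by simp))
    (fun b c => by
      refine unop_injective <|
        LinearMap.ext fun s => Prod.ext ?_ (Prod.ext ?_ (LinearMap.ext fun T => ?_))
      · simp [mul_assoc]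
      · simp [mul_assoc]
      · simp only [LinearMap.coe_mk, AddHom.coe_mk, LinearMap.prodMap_apply,
          LinearMap.lcomp_apply, LinearMap.mulRight_apply, Module.End.mul_apply, unop_op,
          unop_mul]
        congr 1
        exact Subtype.ext (by simp [mul_assoc]))

open Classical in
/-- The action of a vector `ξ` of `X j`. -/
noncomputable def rightActOf (j : K) (ξ : (X j).carrier) : Module.End ℂ (RightState X k) where
  toFun s := (s.1 * of X j ξ, if j = k then 0 else s.1 * of X j ξ,
    if h : j = k then rightEval X k (0, h ▸ ξ) s.2.1 else rightEval X k (1, 0) (s.1 * of X j ξ))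
  map_add' s s' := by
    by_cases h : j = k <;> simp [h, add_mul]
  map_smul' a s := by
    by_cases h : j = k <;> simp [h]

/-- The right action of the free product on the triples. -/
noncomputable def rightAct : FreeProd X →ₐ[ℂ] (Module.End ℂ (RightState X k))ᵐᵒᵖ :=
  lift (rightActBase X k) (fun j ξ => op (rightActOf X k j ξ))
    (fun j ξ η => by
      refine unop_injective (LinearMap.ext fun s => ?_)
      by_cases h : j = k
      · subst h
        refine Prod.ext ?_ (Prod.ext ?_ (LinearMap.ext fun T => ?_))
        · simp [rightActOf, mul_add]
        · simp [rightActOf]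
        · have e : ((0, ξ + η) : (X j).Total) = (0, ξ) + (0, η) := by simp
          simp only [rightActOf, LinearMap.coe_mk, AddHom.coe_mk, dite_true, rightEval_apply, e,
            map_add, mul_add, LinearMap.add_apply, Prod.snd_add, unop_add, unop_op]
      · refine Prod.ext ?_ (Prod.ext ?_ (LinearMap.ext fun T => ?_)) <;>
          simp [rightActOf, h, add_mul, mul_add])
    (fun b j ξ => by
      refine unop_injective (LinearMap.ext fun s => ?_)
      by_cases h : j = k
      · subst h
        refine Prod.ext ?_ (Prod.ext ?_ (LinearMap.ext fun T => ?_))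
        · simp [rightActOf, rightActBase, of_smul_left, mul_assoc]
        · simp [rightActOf, rightActBase]
        · have e : ((0, b • ξ) : (X j).Total) = b • ((0, ξ) : (X j).Total) := by simp
          simp [rightActOf, rightActBase, e, (X j).rightOps_smul, incl_smul_left, mul_assoc,
            -Prod.smul_mk]
      · refine Prod.ext ?_ (Prod.ext ?_ (LinearMap.ext fun T => ?_)) <;>
          simp [rightActOf, rightActBase, h, of_smul_left, mul_assoc])
    (fun b j ξ => by
      refine unop_injective (LinearMap.ext fun s => ?_)
      by_cases h : j = k
      · subst h
        refine Prod.ext ?_ (Prod.ext ?_ (LinearMap.ext fun T => ?_))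
        · simp [rightActOf, rightActBase, of_smul_right, mul_assoc]
        · simp [rightActOf, rightActBase]
        · simp [rightActOf, rightActBase]
      · refine Prod.ext ?_ (Prod.ext ?_ (LinearMap.ext fun T => ?_))
        · simp [rightActOf, rightActBase, of_smul_right, mul_assoc]
        · simp [rightActOf, rightActBase, h, of_smul_right, mul_assoc]
        · have e : (op b • (1, 0) : (X k).Total) = b • ((1, 0) : (X k).Total) := by simp
          simp only [rightActOf, rightActBase, h, of_smul_right, LinearMap.coe_mk,
            AddHom.coe_mk, dite_false, rightEval_apply, AlgHom.ofLinearMap_apply, unop_mul,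
            Module.End.mul_apply, LinearMap.prodMap_apply, LinearMap.lcomp_apply,
            LinearMap.mulRight_apply, Subalgebra.coe_mul, Bimod.R_apply, e,
            (X k).rightOps_smul, incl_smul_left, unop_op, mul_assoc])
    (fun j ξ η => by
      refine unop_injective (LinearMap.ext fun s => ?_)
      by_cases h : j = k
      · subst h
        refine Prod.ext ?_ (Prod.ext ?_ (LinearMap.ext fun T => ?_)) <;>
          simp [rightActOf, mul_assoc, of_mul_of]
      · refine Prod.ext ?_ (Prod.ext ?_ (LinearMap.ext fun T => ?_)) <;>
          simp [rightActOf, h, mul_assoc s.1, of_mul_of])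

@[simp] lemma rightAct_base (b : B) : rightAct X k (base X b) = rightActBase X k b :=
  lift_base ..

@[simp] lemma rightAct_of (j : K) (ξ : (X j).carrier) :
    rightAct X k (of X j ξ) = op (rightActOf X k j ξ) :=
  lift_of ..

/-- The right regular representation `ρ_k : 𝓛_r(B ⊕ X k) → 𝓛(B ⊕ ⨁ ⋯)`. -/
noncomputable def rightReg (T : (X k).rightOps) : Module.End ℂ (FreeProd X) where
  toFun a := ((rightAct X k a).unop (1, 1, rightEval X k (1, 0) 1)).2.2 T
  map_add' a a' := by simp
  map_smul' c a := by simp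

variable {X k}

lemma rightReg_one (T : (X k).rightOps) : rightReg X k T 1 = incl X k (T.1 (1, 0)) := by
  simp [rightReg]

lemma rightReg_mul_base (T : (X k).rightOps) (b : B) (a : FreeProd X) :
    rightReg X k T (a * base X b) =
      rightReg X k (T * ⟨(X k).R (op b), (X k).R_mem_rightOps (op b)⟩) a := by
  simp [rightReg, rightActBase]

lemma rightAct_fst (a : FreeProd X) (s : RightState X k) :
    ((rightAct X k a).unop s).1 = s.1 * a := by
  induction a using FreeProd.induction generalizing s with
  | base b => simp [rightActBase]
  | of j ξ => simp [rightActOf]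
  | mul a b ha hb => rw [map_mul, unop_mul, Module.End.mul_apply, hb, ha, mul_assoc]
  | add a b ha hb => rw [map_add, unop_add, LinearMap.add_apply, Prod.fst_add, ha, hb, mul_add]

/-- On tensors that end with a vector of `X j`, `j ≠ k`. -/
lemma rightReg_mul_of_of_ne {j : K} (h : j ≠ k) (T : (X k).rightOps) (ξ : (X j).carrier)
    (a : FreeProd X) :
    rightReg X k T (a * of X j ξ) = a * of X j ξ * incl X k (T.1 (1, 0)) := by
  have h1 := rightAct_fst (k := k) a (1, 1, rightEval X k (1, 0) 1)
  simp only [one_mul] at h1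
  simp only [rightReg, LinearMap.coe_mk, AddHom.coe_mk, map_mul, unop_mul, Module.End.mul_apply]
  simp [rightActOf, h, h1]

/-- On the vectors of `X k`. -/
lemma rightReg_of (T : (X k).rightOps) (ξ : (X k).carrier) :
    rightReg X k T (of X k ξ) = incl X k (T.1 (0, ξ)) := by
  simp [rightReg, rightActOf]

/-- On tensors that end with a vector of `X j`, `j ≠ k`, followed by a vector of `X k`. -/
lemma rightReg_mul_of_mul_of {j : K} (h : j ≠ k) (T : (X k).rightOps) (ξ : (X k).carrier)
    (η : (X j).carrier) (a : FreeProd X) :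
    rightReg X k T (a * of X j η * of X k ξ) = a * of X j η * incl X k (T.1 (0, ξ)) := by
  have h1 := rightAct_fst (k := k) a (1, 1, rightEval X k (1, 0) 1)
  simp only [one_mul] at h1
  simp only [rightReg, LinearMap.coe_mk, AddHom.coe_mk, map_mul, unop_mul, Module.End.mul_apply]
  simp [rightActOf, h, h1]

end RightRegular

end FreeProd

end FreeProduct

/-! ### Bi-freeness with amalgamation -/

section BiFree

variable {B : Type u} {A : Type v} [Ring B] [Algebra ℂ B] [Ring A] [Algebra ℂ A]

/-- A letter is an element of one of the left faces `C k` or of one of the right faces `D k`. -/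
abbrev Letter {K : Type y} (C : K → Type z) (D : K → Type t) := Σ k, C k ⊕ D k

/-- The element of `A` given by a letter. -/
def Letter.val {K : Type y} {C : K → Type z} {D : K → Type t}
    [∀ k, Ring (C k)] [∀ k, Algebra ℂ (C k)] [∀ k, Ring (D k)] [∀ k, Algebra ℂ (D k)]
    (γ : ∀ k, C k →ₐ[ℂ] A) (δ : ∀ k, D k →ₐ[ℂ] A) : Letter C D → A
  | ⟨k, Sum.inl c⟩ => γ k c
  | ⟨k, Sum.inr d⟩ => δ k d

/-- The operator `λ_k(l_k(c))` or `ρ_k(r_k(d))` on the free product given by a letter. -/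
noncomputable def Letter.toEnd {K : Type y} {C : K → Type z} {D : K → Type t}
    [∀ k, Ring (C k)] [∀ k, Algebra ℂ (C k)] [∀ k, Ring (D k)] [∀ k, Algebra ℂ (D k)]
    {X : K → Bimod.{u, w} B}
    (l : ∀ k, C k →ₐ[ℂ] (X k).leftOps) (r : ∀ k, D k →ₐ[ℂ] (X k).rightOps) :
    Letter C D → Module.End ℂ (FreeProd X)
  | ⟨k, Sum.inl c⟩ => FreeProd.leftReg X k (l k c)
  | ⟨k, Sum.inr d⟩ => FreeProd.rightReg X k (r k d)

/-- The pairs of `B`-faces `(C k, D k)` of `A` are bi-free with amalgamation over `B`.  The faces are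
unital algebras together with the unital homomorphisms `γ k`, `δ k` by which they are viewed inside
`A`; for subalgebras of `A` these are the inclusions.  The bimodules `B ⊕ X k` with specified
`B`-vector states are to be found in the universe `w`. -/
def IsBiFree.{w', u', v', y', z', t'} {B : Type u'} {A : Type v'} [Ring B] [Algebra ℂ B]
    [Ring A] [Algebra ℂ A] (P : NCPS B A)
    {K : Type y'} {C : K → Type z'} {D : K → Type t'}
    [∀ k, Ring (C k)] [∀ k, Algebra ℂ (C k)] [∀ k, Ring (D k)] [∀ k, Algebra ℂ (D k)]
    (γ : ∀ k, C k →ₐ[ℂ] A) (δ : ∀ k, D k →ₐ[ℂ] A) : Prop :=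
  (∀ k, P.IsPairOfFaces (γ k).range (δ k).range) ∧
    ∃ (X : K → Bimod.{u', w'} B)
      (l : ∀ k, C k →ₐ[ℂ] (X k).leftOps) (r : ∀ k, D k →ₐ[ℂ] (X k).rightOps),
      ∀ W : List (Letter C D),
        P.E (W.map (Letter.val γ δ)).prod =
          FreeProd.expectation X (W.map (Letter.toEnd l r)).prod

end BiFree

/-! ### Concrete representations -/

section Representation

variable {B : Type u} {A : Type v} [Ring B] [Algebra ℂ B] [Ring A] [Algebra ℂ A]

/-- A representation of the `B`-`B`-non-commutative probability space `A` on a `B`-`B`-bimodule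
`B ⊕ X₀` with specified `B`-vector state.  (That `θ` maps `A_ℓ` and `A_r` into the left and right
algebras follows from `map_ε`.) -/
structure Representation (P : NCPS B A) where
  X₀ : Bimod.{u, x} B
  θ : A →ₐ[ℂ] Module.End ℂ X₀.Total
  map_ε : ∀ b₁ b₂ : B, θ (P.ε (b₁ ⊗ₜ op b₂)) = X₀.L b₁ * X₀.R (op b₂)
  expectation_θ : ∀ Z : A, X₀.expectation (θ Z) = P.E Z

namespace Representation

variable {P : NCPS B A} (ϑ : Representation.{u, v, x} P)

lemma θ_mem_leftOps {Z : A} (hZ : Z ∈ P.leftAlg) : ϑ.θ Z ∈ ϑ.X₀.leftOps := by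
  rintro _ ⟨b, rfl⟩
  have h := ϑ.map_ε 1 b.unop
  rw [map_one, one_mul, op_unop] at h
  rw [← h, ← map_mul, ← map_mul]
  exact congrArg ϑ.θ (hZ _ ⟨b.unop, rfl⟩)

lemma θ_mem_rightOps {Z : A} (hZ : Z ∈ P.rightAlg) : ϑ.θ Z ∈ ϑ.X₀.rightOps := by
  rintro _ ⟨b, rfl⟩
  have h := ϑ.map_ε b 1
  rw [op_one, map_one, mul_one] at h
  rw [← h, ← map_mul, ← map_mul]
  exact congrArg ϑ.θ (hZ _ ⟨b, rfl⟩)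

end Representation

namespace NCPS

variable (P : NCPS B A)

/-- The left ideal of `A` generated by the elements `L_b - R_b`. -/
def diffIdeal : Submodule A A :=
  Submodule.span A (Set.range fun b : B => P.ε (b ⊗ₜ 1) - P.ε (1 ⊗ₜ op b))

lemma ε_left_mul_right (b c : B) :
    P.ε (1 ⊗ₜ op c) * P.ε (b ⊗ₜ 1) = P.ε (b ⊗ₜ 1) * P.ε (1 ⊗ₜ op c) := by
  simp [← map_mul]

lemma E_left (b : B) (Z : A) : P.E (P.ε (b ⊗ₜ 1) * Z) = b * P.E Z := by
  simpa using P.E_smul b 1 Z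

lemma E_op (b : B) (Z : A) : P.E (P.ε (1 ⊗ₜ op b) * Z) = P.E Z * b := by
  simpa using P.E_smul 1 b Z

lemma E_mul_eq_zero {Z : A} (hZ : Z ∈ P.diffIdeal) (a : A) : P.E (a * Z) = 0 := by
  induction hZ using Submodule.span_induction generalizing a with
  | mem Z h =>
    obtain ⟨b, rfl⟩ := h
    simpa [sub_eq_zero, mul_sub] using P.E_right b a
  | zero => simp
  | add Z W _ _ hZ hW => rw [mul_add, map_add, hZ, hW, add_zero]
  | smul c Z _ hZ => rw [smul_eq_mul, ← mul_assoc, hZ]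

/-- The left `A`-module on which `A` is represented. -/
abbrev Quot : Type v := A ⧸ P.diffIdeal

/-- The map induced by `E` on the quotient. -/
def quotE : P.Quot →ₗ[ℂ] B :=
  (P.diffIdeal.restrictScalars ℂ).liftQ P.E fun Z hZ => by
    simpa using P.E_mul_eq_zero hZ 1

lemma quotE_mk (Z : A) : P.quotE (Submodule.Quotient.mk Z) = P.E Z := rfl

lemma quotE_left (b : B) (q : P.Quot) : P.quotE (P.ε (b ⊗ₜ 1) • q) = b * P.quotE q := by
  obtain ⟨Z, rfl⟩ := Submodule.Quotient.mk_surjective _ q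
  exact P.E_left b Z

lemma quotE_op (b : B) (q : P.Quot) : P.quotE (P.ε (1 ⊗ₜ op b) • q) = P.quotE q * b := by
  obtain ⟨Z, rfl⟩ := Submodule.Quotient.mk_surjective _ q
  exact P.E_op b Z

/-- The bimodule `ker E / span {Z L_b - Z R_b}`, with the actions of `b` by `L_b` and `R_b`. -/
def kerBimod : Bimod.{u, v} B :=
  letI mL : Module B P.quotE.ker := Module.compHom _
    ({ toFun := fun b => (Algebra.lsmul ℂ ℂ P.Quot (P.ε (b ⊗ₜ 1))).restrict fun q hq => by
          simp only [LinearMap.mem_ker] at hq ⊢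
          exact (P.quotE_left b q).trans (by rw [hq, mul_zero])
       map_one' := by ext q; simp [← Algebra.TensorProduct.one_def]
       map_mul' := fun b c => by
        ext q
        have h : P.ε ((b * c) ⊗ₜ 1) = P.ε (b ⊗ₜ 1) * P.ε (c ⊗ₜ 1) := by simp [← map_mul]
        simp [h, mul_smul]
       map_zero' := by ext q; simp
       map_add' := fun b c => by ext q; simp [TensorProduct.add_tmul, add_smul] } :
      B →+* Module.End ℂ P.quotE.ker)
  letI mR : Module Bᵐᵒᵖ P.quotE.ker := Module.compHom _
    ({ toFun := fun b => (Algebra.lsmul ℂ ℂ P.Quot (P.ε (1 ⊗ₜ b))).restrict fun q hq => by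
          simp only [LinearMap.mem_ker] at hq ⊢
          exact (P.quotE_op b.unop q).trans (by rw [hq, zero_mul])
       map_one' := by ext q; simp [← Algebra.TensorProduct.one_def]
       map_mul' := fun b c => by
        ext q
        have h : P.ε (1 ⊗ₜ (b * c)) = P.ε (1 ⊗ₜ b) * P.ε (1 ⊗ₜ c) := by simp [← map_mul]
        simp [h, mul_smul]
       map_zero' := by ext q; simp
       map_add' := fun b c => by ext q; simp [TensorProduct.tmul_add, add_smul] } :
      Bᵐᵒᵖ →+* Module.End ℂ P.quotE.ker)
  { carrier := P.quotE.ker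
    smulComm := ⟨fun b c q => Subtype.ext <| by
      change P.ε (b ⊗ₜ 1) • P.ε (1 ⊗ₜ c) • q.1 = P.ε (1 ⊗ₜ c) • P.ε (b ⊗ₜ 1) • q.1
      rw [← mul_smul, ← mul_smul, ← op_unop c, P.ε_left_mul_right]⟩
    towerLeft := ⟨fun a b q => Subtype.ext <| by
      change P.ε ((a • b) ⊗ₜ 1) • q.1 = a • P.ε (b ⊗ₜ 1) • q.1
      rw [← TensorProduct.smul_tmul', map_smul, smul_assoc]⟩
    towerRight := ⟨fun a b q => Subtype.ext <| by
      change P.ε (1 ⊗ₜ (a • b)) • q.1 = a • P.ε (1 ⊗ₜ b) • q.1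
      rw [TensorProduct.tmul_smul, map_smul, smul_assoc]⟩ }

/-- The image of `1` in the quotient. -/
def quotOne : P.Quot := Submodule.Quotient.mk 1

lemma quotE_one : P.quotE P.quotOne = 1 := P.E_one

lemma ε_smul_quotOne (b : B) : P.ε (1 ⊗ₜ op b) • P.quotOne = P.ε (b ⊗ₜ 1) • P.quotOne := by
  refine ((Submodule.Quotient.eq _).2 ?_).symm
  simp only [smul_eq_mul, mul_one]
  exact Submodule.subset_span ⟨b, rfl⟩

/-- The inclusion of `ker E / span {Z L_b - Z R_b}` in the quotient. -/
def kerVal : P.kerBimod.carrier →ₗ[ℂ] P.Quot := P.quotE.ker.subtype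

lemma kerVal_left (b : B) (q : P.kerBimod.carrier) :
    P.kerVal (b • q) = P.ε (b ⊗ₜ 1) • P.kerVal q := rfl

lemma kerVal_right (b : Bᵐᵒᵖ) (q : P.kerBimod.carrier) :
    P.kerVal (b • q) = P.ε (1 ⊗ₜ b) • P.kerVal q := rfl

lemma quotE_kerVal (q : P.kerBimod.carrier) : P.quotE (P.kerVal q) = 0 := q.2

/-- The identification of `B ⊕ ker E / span {Z L_b - Z R_b}` with the quotient. -/
def quotEquiv : P.kerBimod.Total ≃ₗ[ℂ] P.Quot where
  toFun v := P.ε (v.1 ⊗ₜ 1) • P.quotOne + P.kerVal v.2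
  map_add' v v' := by
    rw [Prod.fst_add, Prod.snd_add, TensorProduct.add_tmul, map_add, map_add, add_smul]
    abel
  map_smul' c v := by
    rw [Prod.smul_fst, Prod.smul_snd, ← TensorProduct.smul_tmul', map_smul, map_smul,
      smul_assoc, RingHom.id_apply, smul_add]
  invFun q := (P.quotE q, ⟨q - P.ε (P.quotE q ⊗ₜ 1) • P.quotOne, by
    rw [LinearMap.mem_ker, map_sub, quotE_left, quotE_one, mul_one, sub_self]⟩)
  left_inv v := by
    have h : P.quotE (P.ε (v.1 ⊗ₜ 1) • P.quotOne + P.kerVal v.2) = v.1 := by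
      rw [map_add, quotE_left, quotE_one, quotE_kerVal, mul_one, add_zero]
    refine Prod.ext h (Subtype.ext ?_)
    simp only [h]
    exact add_sub_cancel_left _ _
  right_inv q := add_sub_cancel _ _

lemma quotEquiv_left (b : B) (v : P.kerBimod.Total) :
    P.quotEquiv (b • v) = P.ε (b ⊗ₜ 1) • P.quotEquiv v := by
  have h : P.ε ((b * v.1) ⊗ₜ 1) = P.ε (b ⊗ₜ 1) * P.ε (v.1 ⊗ₜ 1) := by simp [← map_mul]
  change P.ε ((b * v.1) ⊗ₜ 1) • P.quotOne + P.kerVal (b • v.2) =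
    P.ε (b ⊗ₜ 1) • (P.ε (v.1 ⊗ₜ 1) • P.quotOne + P.kerVal v.2)
  rw [kerVal_left, smul_add, h, mul_smul]

lemma quotEquiv_right (b : B) (v : P.kerBimod.Total) :
    P.quotEquiv (op b • v) = P.ε (1 ⊗ₜ op b) • P.quotEquiv v := by
  have h : P.ε ((v.1 * b) ⊗ₜ 1) = P.ε (v.1 ⊗ₜ 1) * P.ε (b ⊗ₜ 1) := by simp [← map_mul]
  change P.ε ((v.1 * b) ⊗ₜ 1) • P.quotOne + P.kerVal (op b • v.2) =
    P.ε (1 ⊗ₜ op b) • (P.ε (v.1 ⊗ₜ 1) • P.quotOne + P.kerVal v.2)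
  rw [kerVal_right, smul_add, h, ← mul_smul, ε_left_mul_right, mul_smul, mul_smul,
    ε_smul_quotOne]

/-- Every `B`-`B`-non-commutative probability space has a representation: the left multiplication
on the quotient of `A` by `span {Z L_b - Z R_b}`. -/
def canonicalRepresentation : Representation.{u, v, v} P where
  X₀ := P.kerBimod
  θ := ((P.quotEquiv.symm.conjAlgEquiv ℂ).toAlgHom).comp (Algebra.lsmul ℂ ℂ P.Quot)
  map_ε b₁ b₂ := by
    refine LinearMap.ext fun v => P.quotEquiv.injective ?_
    have h : P.ε (b₁ ⊗ₜ op b₂) = P.ε (b₁ ⊗ₜ 1) * P.ε (1 ⊗ₜ op b₂) := by simp [← map_mul]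
    refine (P.quotEquiv.apply_symm_apply _).trans ?_
    change P.ε (b₁ ⊗ₜ op b₂) • P.quotEquiv v = P.quotEquiv (b₁ • op b₂ • v)
    rw [quotEquiv_left, quotEquiv_right, h, mul_smul]
  expectation_θ Z := by
    change P.quotE (Z • P.quotEquiv (1, 0)) = P.E Z
    have h : P.quotEquiv (1, 0) = P.quotOne := by
      change P.ε (1 ⊗ₜ 1) • P.quotOne + P.kerVal 0 = P.quotOne
      rw [map_zero, add_zero, ← Algebra.TensorProduct.one_def, map_one, one_smul]
    rw [h]
    exact congrArg P.E (mul_one Z)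

end NCPS

end Representation

/-! ### Matrices -/

section Matrices

variable {B : Type u} [Ring B] [Algebra ℂ B] (n : ℕ)

namespace Bimod

variable (X₀ : Bimod.{u, w} B)

/-- The `M_n(B)`-`M_n(B)`-bimodule `M_n(X₀)`, with the actions
`[b_ij] • [ξ_ij] = [∑ m, b_im • ξ_mj]` and `[ξ_ij] • [b_ij] = [∑ m, ξ_im • b_mj]`. -/
def matrix : Bimod.{u, w} (Matrix (Fin n) (Fin n) B) :=
  letI mL : Module (Matrix (Fin n) (Fin n) B) (Matrix (Fin n) (Fin n) X₀.carrier) :=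
    { smul := fun b ξ => Matrix.of fun i j => ∑ m, b i m • ξ m j
      one_smul := fun ξ => Matrix.ext fun i j => by
        change ∑ m, (1 : Matrix (Fin n) (Fin n) B) i m • ξ m j = ξ i j
        simp [Matrix.one_apply, ite_smul]
      mul_smul := fun b c ξ => Matrix.ext fun i j => by
        change ∑ m, (b * c) i m • ξ m j = ∑ m, b i m • ∑ k, c m k • ξ k j
        simp only [Matrix.mul_apply, Finset.sum_smul, Finset.smul_sum, mul_smul]
        exact Finset.sum_comm
      smul_zero := fun b => Matrix.ext fun i j => by
        change ∑ m, b i m • (0 : X₀.carrier) = 0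
        simp
      smul_add := fun b ξ η => Matrix.ext fun i j => by
        change ∑ m, b i m • (ξ m j + η m j) = ∑ m, b i m • ξ m j + ∑ m, b i m • η m j
        simp only [smul_add, Finset.sum_add_distrib]
      add_smul := fun b c ξ => Matrix.ext fun i j => by
        change ∑ m, (b i m + c i m) • ξ m j = ∑ m, b i m • ξ m j + ∑ m, c i m • ξ m j
        simp only [add_smul, Finset.sum_add_distrib]
      zero_smul := fun ξ => Matrix.ext fun i j => by
        change ∑ m, (0 : B) • ξ m j = 0
        simp }
  letI mR : Module (Matrix (Fin n) (Fin n) B)ᵐᵒᵖ (Matrix (Fin n) (Fin n) X₀.carrier) :=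
    { smul := fun b ξ => Matrix.of fun i j => ∑ m, op (b.unop m j) • ξ i m
      one_smul := fun ξ => Matrix.ext fun i j => by
        change ∑ m, op ((1 : Matrix (Fin n) (Fin n) B) m j) • ξ i m = ξ i j
        rw [Finset.sum_eq_single j] <;> simp +contextual [Matrix.one_apply]
      mul_smul := fun b c ξ => Matrix.ext fun i j => by
        change ∑ m, op ((c.unop * b.unop) m j) • ξ i m =
          ∑ m, op (b.unop m j) • ∑ k, op (c.unop k m) • ξ i k
        simp only [Matrix.mul_apply, Finset.op_sum, op_mul, Finset.sum_smul, Finset.smul_sum,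
          mul_smul]
        exact Finset.sum_comm
      smul_zero := fun b => Matrix.ext fun i j => by
        change ∑ m, op (b.unop m j) • (0 : X₀.carrier) = 0
        simp
      smul_add := fun b ξ η => Matrix.ext fun i j => by
        change ∑ m, op (b.unop m j) • (ξ i m + η i m) =
          ∑ m, op (b.unop m j) • ξ i m + ∑ m, op (b.unop m j) • η i m
        simp only [smul_add, Finset.sum_add_distrib]
      add_smul := fun b c ξ => Matrix.ext fun i j => by
        change ∑ m, (op (b.unop m j) + op (c.unop m j)) • ξ i m =
          ∑ m, op (b.unop m j) • ξ i m + ∑ m, op (c.unop m j) • ξ i m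
        simp only [add_smul, Finset.sum_add_distrib]
      zero_smul := fun ξ => Matrix.ext fun i j => by
        change ∑ m, (0 : Bᵐᵒᵖ) • ξ i m = 0
        simp }
  { carrier := Matrix (Fin n) (Fin n) X₀.carrier
    smulComm := ⟨fun b c ξ => Matrix.ext fun i j => by
      change ∑ m, b i m • ∑ k, op (c.unop k j) • ξ m k =
        ∑ k, op (c.unop k j) • ∑ m, b i m • ξ m k
      simp only [Finset.smul_sum]
      rw [Finset.sum_comm]
      simp only [smul_comm (b i _) (op (c.unop _ j))]⟩
    towerLeft := ⟨fun a b ξ => Matrix.ext fun i j => by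
      change ∑ m, (a • b i m) • ξ m j = a • ∑ m, b i m • ξ m j
      simp only [Finset.smul_sum, smul_assoc]⟩
    towerRight := ⟨fun a b ξ => Matrix.ext fun i j => by
      change ∑ m, (a • op (b.unop m j)) • ξ i m = a • ∑ m, op (b.unop m j) • ξ i m
      simp only [Finset.smul_sum, smul_assoc]⟩ }

/-- The identification `M_n(B) ⊕ M_n(X₀) = M_n(B ⊕ X₀)`. -/
def entries : (X₀.matrix n).Total ≃ₗ[ℂ] Matrix (Fin n) (Fin n) X₀.Total where
  toFun v := Matrix.of fun i j => (v.1 i j, (show Matrix (Fin n) (Fin n) X₀.carrier from v.2) i j)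
  map_add' _ _ := rfl
  map_smul' _ _ := rfl
  invFun M := (M.map Prod.fst, (M.map Prod.snd : Matrix (Fin n) (Fin n) X₀.carrier))
  left_inv _ := rfl
  right_inv _ := rfl

/-- A matrix `[Z_ij]` of operators as the operator `[ξ_ij] ↦ [∑ m, Z_im ξ_mj]`. -/
def matrixLeft : Matrix (Fin n) (Fin n) (Module.End ℂ X₀.Total) →ₐ[ℂ]
    Module.End ℂ (X₀.matrix n).Total :=
  (((X₀.entries n).symm.conjAlgEquiv ℂ).toAlgHom).comp <|
    AlgHom.ofLinearMap
      { toFun := fun Z =>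
          { toFun := fun ξ => Matrix.of fun i j => ∑ m, Z i m (ξ m j)
            map_add' := fun ξ η => Matrix.ext fun i j => by simp [Finset.sum_add_distrib]
            map_smul' := fun a ξ => Matrix.ext fun i j => by simp [Finset.smul_sum] }
        map_add' := fun Z W => LinearMap.ext fun ξ => Matrix.ext fun i j => by
          simp [Finset.sum_add_distrib]
        map_smul' := fun a Z => LinearMap.ext fun ξ => Matrix.ext fun i j => by
          simp [Finset.smul_sum] }
      (LinearMap.ext fun ξ => Matrix.ext fun i j => by
        change ∑ m, (1 : Matrix (Fin n) (Fin n) (Module.End ℂ X₀.Total)) i m (ξ m j) = ξ i j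
        rw [Finset.sum_eq_single i] <;> simp +contextual [Matrix.one_apply, eq_comm])
      (fun Z W => LinearMap.ext fun ξ => Matrix.ext fun i j => by
        change ∑ m, (Z * W) i m (ξ m j) = ∑ m, Z i m (∑ k, W m k (ξ k j))
        simp only [Matrix.mul_apply, LinearMap.sum_apply, Module.End.mul_apply, map_sum]
        exact Finset.sum_comm)

/-- A matrix `[Z_ij]` of operators as the operator `[ξ_ij] ↦ [∑ m, Z_mj ξ_im]`; this is a
homomorphism on `M_n(𝓛ᵒᵖ)ᵒᵖ`. -/
def matrixRight : (Matrix (Fin n) (Fin n) (Module.End ℂ X₀.Total)ᵐᵒᵖ)ᵐᵒᵖ →ₐ[ℂ]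
    Module.End ℂ (X₀.matrix n).Total :=
  (((X₀.entries n).symm.conjAlgEquiv ℂ).toAlgHom).comp <|
    AlgHom.ofLinearMap
      { toFun := fun Z =>
          { toFun := fun ξ => Matrix.of fun i j => ∑ m, (Z.unop m j).unop (ξ i m)
            map_add' := fun ξ η => Matrix.ext fun i j => by simp [Finset.sum_add_distrib]
            map_smul' := fun a ξ => Matrix.ext fun i j => by simp [Finset.smul_sum] }
        map_add' := fun Z W => LinearMap.ext fun ξ => Matrix.ext fun i j => by
          simp [Finset.sum_add_distrib]
        map_smul' := fun a Z => LinearMap.ext fun ξ => Matrix.ext fun i j => by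
          simp [Finset.smul_sum] }
      (LinearMap.ext fun ξ => Matrix.ext fun i j => by
        change ∑ m, ((1 : Matrix (Fin n) (Fin n) (Module.End ℂ X₀.Total)ᵐᵒᵖ) m j).unop (ξ i m) =
          ξ i j
        rw [Finset.sum_eq_single j] <;> simp +contextual [Matrix.one_apply])
      (fun Z W => LinearMap.ext fun ξ => Matrix.ext fun i j => by
        change ∑ m, ((W.unop * Z.unop) m j).unop (ξ i m) =
          ∑ m, (Z.unop m j).unop (∑ k, (W.unop k m).unop (ξ i k))
        simp only [Matrix.mul_apply, Finset.unop_sum, unop_mul, LinearMap.sum_apply,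
          Module.End.mul_apply, map_sum]
        exact Finset.sum_comm)

end Bimod

namespace Representation

variable {A : Type v} [Ring A] [Algebra ℂ A] {P : NCPS B A} (ϑ : Representation.{u, v, x} P)

/-- `M_n(C)` viewed in `𝓛(M_n(B ⊕ X₀))` by `[Z_ij] [ξ_ij] = [∑ m, Z_im ξ_mj]`. -/
def matrixLeftFace (C : Subalgebra ℂ A) :
    Matrix (Fin n) (Fin n) C →ₐ[ℂ] Module.End ℂ (ϑ.X₀.matrix n).Total :=
  (ϑ.X₀.matrixLeft n).comp (ϑ.θ.comp C.val).mapMatrix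

/-- `M_n(Dᵒᵖ)ᵒᵖ` viewed in `𝓛(M_n(B ⊕ X₀))` by `[Z_ij] [ξ_ij] = [∑ m, Z_mj ξ_im]`. -/
def matrixRightFace (D : Subalgebra ℂ A) :
    (Matrix (Fin n) (Fin n) (D : Type v)ᵐᵒᵖ)ᵐᵒᵖ →ₐ[ℂ] Module.End ℂ (ϑ.X₀.matrix n).Total :=
  (ϑ.X₀.matrixRight n).comp (AlgHom.op (AlgHom.op (ϑ.θ.comp D.val)).mapMatrix)

end Representation

end Matrices

end BiFreeProb

namespace BiFreeProb

open scoped TensorProduct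
open MulOpposite

/-! ### Matrices of operators -/

namespace Bimod

variable {B : Type u} [Ring B] [Algebra ℂ B] (n : ℕ) (X₀ : Bimod.{u, w} B)

/-! The pairs of matrix faces are realised on the bimodules `M_n(X k)`, where the `X k` come from
the assumed bi-freeness: a matrix over `C k` acts through the matrix of its images under `l k`, and
a matrix over `D k` through `r k` in the same way.

The bridge is the algebra homomorphism `FreeProd.toMatrix` from the free product of the `M_n(X k)`
to the matrices over the free product of the `X k`, which sends a tensor of matrices to its matrix
product with entries multiplied as tensors. It sends the vacuum vector `1` to the identity matrix,
it carries the vector state to the entrywise vector state (`FreeProd.proj_toMatrix`), and it turns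
the regular representations of a matrix of operators into the matrix of the regular representations
of its entries (`FreeProd.toMatrix_leftReg`, `FreeProd.toMatrix_rightReg`). Only this intertwining
is needed; whether `FreeProd.toMatrix` is bijective plays no role.

Hence a word in matrix letters acts by the same formal rule on both sides: left letters multiply
along the row index, right letters along the column index. Applied to a vacuum vector, it produces
in entry `(i, j)` one noncommutative polynomial in the original letters, the same polynomial for the
given representation as for the free product (`apply_prod_eq_matrixWord`). By the assumed
bi-freeness the two expectations agree on every word in the original letters, hence by linearity on
every polynomial (`freeAlgebra_linearMap_ext`), and so on every entry of every matrix word. -/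

lemma entries_matrixLeft (Z : Matrix (Fin n) (Fin n) (Module.End ℂ X₀.Total))
    (ξ : (X₀.matrix n).Total) (i j : Fin n) :
    X₀.entries n (X₀.matrixLeft n Z ξ) i j = ∑ m, Z i m (X₀.entries n ξ m j) := rfl

lemma entries_matrixRight (Z : (Matrix (Fin n) (Fin n) (Module.End ℂ X₀.Total)ᵐᵒᵖ)ᵐᵒᵖ)
    (ξ : (X₀.matrix n).Total) (i j : Fin n) :
    X₀.entries n (X₀.matrixRight n Z ξ) i j =
      ∑ m, (Z.unop m j).unop (X₀.entries n ξ i m) := rfl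

lemma entries_smul_left (b : Matrix (Fin n) (Fin n) B) (ξ : (X₀.matrix n).Total) (i j : Fin n) :
    X₀.entries n (b • ξ) i j = ∑ m, b i m • X₀.entries n ξ m j := by
  refine Prod.ext ?_ ?_
  · rw [Prod.fst_sum]; rfl
  · rw [Prod.snd_sum]; rfl

lemma entries_smul_right (b : (Matrix (Fin n) (Fin n) B)ᵐᵒᵖ) (ξ : (X₀.matrix n).Total)
    (i j : Fin n) :
    X₀.entries n (b • ξ) i j = ∑ m, op (b.unop m j) • X₀.entries n ξ i m := by
  refine Prod.ext ?_ ?_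
  · rw [Prod.fst_sum]; rfl
  · rw [Prod.snd_sum]; rfl

/-- The vacuum of `M_n(B ⊕ X₀)` is the diagonal matrix of vacua, the starting vector required by
`apply_prod_eq_matrixWord`. -/
lemma entries_one (i j : Fin n) :
    X₀.entries n (1, 0) i j = if i = j then (1, 0) else 0 := by
  change (((1 : Matrix (Fin n) (Fin n) B) i j, 0) : X₀.Total) = _
  rw [Matrix.one_apply]
  split_ifs <;> rfl

variable {n X₀} in
lemma entries_ext {S T : Module.End ℂ (X₀.matrix n).Total}
    (h : ∀ ξ i j, X₀.entries n (S ξ) i j = X₀.entries n (T ξ) i j) : S = T :=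
  LinearMap.ext fun ξ => (X₀.entries n).injective (Matrix.ext (h ξ))

lemma matrixLeft_map_L (b : Matrix (Fin n) (Fin n) B) :
    X₀.matrixLeft n (b.map X₀.L) = (X₀.matrix n).L b :=
  entries_ext fun ξ i j => (X₀.entries_smul_left n b ξ i j).symm

lemma matrixRight_map_R (b : Matrix (Fin n) (Fin n) B) :
    X₀.matrixRight n (op (b.map fun c => op (X₀.R (op c)))) = (X₀.matrix n).R (op b) :=
  entries_ext fun ξ i j => (X₀.entries_smul_right n (op b) ξ i j).symm

/-- A left matrix sums over the row index and the right action of `M_n(B)` over the column index, so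
the two can fail to commute only through their entries; those commute by assumption. -/
lemma matrixLeft_mem_leftOps {Z : Matrix (Fin n) (Fin n) (Module.End ℂ X₀.Total)}
    (hZ : ∀ i j, Z i j ∈ X₀.leftOps) : X₀.matrixLeft n Z ∈ (X₀.matrix n).leftOps := by
  rintro _ ⟨c, rfl⟩
  refine entries_ext fun ξ i j => ?_
  simp only [Module.End.mul_apply, R_apply, entries_smul_right, entries_matrixLeft, map_sum,
    X₀.leftOps_smul ⟨_, hZ _ _⟩, Finset.smul_sum]
  exact Finset.sum_comm

lemma matrixRight_mem_rightOps
    {Z : (Matrix (Fin n) (Fin n) (Module.End ℂ X₀.Total)ᵐᵒᵖ)ᵐᵒᵖ}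
    (hZ : ∀ i j, (Z.unop i j).unop ∈ X₀.rightOps) :
    X₀.matrixRight n Z ∈ (X₀.matrix n).rightOps := by
  rintro _ ⟨b, rfl⟩
  refine entries_ext fun ξ i j => ?_
  simp only [Module.End.mul_apply, L_apply, entries_smul_left, entries_matrixRight, map_sum,
    Finset.smul_sum]
  rw [Finset.sum_comm]
  exact Finset.sum_congr rfl fun m _ => Finset.sum_congr rfl fun k _ =>
    (X₀.rightOps_smul ⟨_, hZ m j⟩ _ _).symm

/-- A matrix of operators in the left algebra, as an operator in the left algebra. -/
def matrixLeftOps : Matrix (Fin n) (Fin n) X₀.leftOps →ₐ[ℂ] (X₀.matrix n).leftOps :=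
  ((X₀.matrixLeft n).comp X₀.leftOps.val.mapMatrix).codRestrict _ fun Z =>
    X₀.matrixLeft_mem_leftOps n fun i j => (Z i j).2

/-- A matrix of operators in the right algebra, as an operator in the right algebra. -/
def matrixRightOps :
    (Matrix (Fin n) (Fin n) X₀.rightOpsᵐᵒᵖ)ᵐᵒᵖ →ₐ[ℂ] (X₀.matrix n).rightOps :=
  ((X₀.matrixRight n).comp
    (AlgHom.op (AlgHom.op X₀.rightOps.val).mapMatrix)).codRestrict _ fun Z =>
      X₀.matrixRight_mem_rightOps n fun i j => (Z.unop i j).unop.2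

lemma entries_matrixLeftOps (Z : Matrix (Fin n) (Fin n) X₀.leftOps)
    (ξ : (X₀.matrix n).Total) (i j : Fin n) :
    X₀.entries n ((X₀.matrixLeftOps n Z).1 ξ) i j = ∑ m, (Z i m).1 (X₀.entries n ξ m j) := rfl

lemma entries_matrixRightOps (Z : (Matrix (Fin n) (Fin n) X₀.rightOpsᵐᵒᵖ)ᵐᵒᵖ)
    (ξ : (X₀.matrix n).Total) (i j : Fin n) :
    X₀.entries n ((X₀.matrixRightOps n Z).1 ξ) i j =
      ∑ m, (Z.unop m j).unop.1 (X₀.entries n ξ i m) := rfl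

end Bimod

/-! ### The matrix faces form pairs of `M_n(B)`-faces -/

namespace Representation

variable {B : Type u} {A : Type v} [Ring B] [Algebra ℂ B] [Ring A] [Algebra ℂ A]
  {P : NCPS B A} (ϑ : Representation.{u, v, x} P) (n : ℕ)

lemma θ_left (b : B) : ϑ.θ (P.ε (b ⊗ₜ 1)) = ϑ.X₀.L b := by
  simpa using ϑ.map_ε b 1

lemma θ_right (b : B) : ϑ.θ (P.ε (1 ⊗ₜ op b)) = ϑ.X₀.R (op b) := by
  simpa using ϑ.map_ε 1 b

/-- A scalar matrix over `B` acts as the matrix of the operators `L_b` or `R_b` of its entries, and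
these lie in the faces. The commutation relations hold because `θ` maps `A_ℓ` and `A_r` into the
left and right algebras. -/
lemma isPairOfFaces_matrix {C D : Subalgebra ℂ A} (h : P.IsPairOfFaces C D) :
    (ϑ.X₀.matrix n).ncps.IsPairOfFaces (ϑ.matrixLeftFace n C).range
      (ϑ.matrixRightFace n D).range := by
  have hL (b : Matrix (Fin n) (Fin n) B) :
      (ϑ.X₀.matrix n).ncps.ε (b ⊗ₜ 1) = (ϑ.X₀.matrix n).L b := by
    simp [Bimod.ncps]
  have hR (b : Matrix (Fin n) (Fin n) B) :
      (ϑ.X₀.matrix n).ncps.ε (1 ⊗ₜ op b) = (ϑ.X₀.matrix n).R (op b) := by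
    simp [Bimod.ncps]
  refine ⟨⟨fun b => ?_, ?_⟩, fun b => ?_, ?_⟩
  · refine ⟨Matrix.of fun i j => ⟨_, h.1.1 (b i j)⟩, ?_⟩
    rw [hL, ← Bimod.matrixLeft_map_L]
    exact congrArg (ϑ.X₀.matrixLeft n) (Matrix.ext fun i j => ϑ.θ_left (b i j))
  · rintro _ ⟨Z, rfl⟩ _ ⟨b, rfl⟩
    simp only [hR]
    exact ϑ.X₀.matrixLeft_mem_leftOps n (fun i j => ϑ.θ_mem_leftOps (h.1.2 (Z i j).2)) _
      ⟨op b, rfl⟩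
  · refine ⟨op (Matrix.of fun i j => op ⟨_, h.2.1 (b i j)⟩), ?_⟩
    rw [hR, ← Bimod.matrixRight_map_R]
    exact congrArg (fun M => ϑ.X₀.matrixRight n (op M))
      (Matrix.ext fun i j => congrArg op (ϑ.θ_right (b i j)))
  · rintro _ ⟨Z, rfl⟩ _ ⟨b, rfl⟩
    simp only [hL]
    exact ϑ.X₀.matrixRight_mem_rightOps n
      (Z := AlgHom.op (AlgHom.op (ϑ.θ.comp D.val)).mapMatrix Z)
      (fun i j => ϑ.θ_mem_rightOps (h.2.2 (Z.unop i j).unop.2)) _ ⟨b, rfl⟩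

end Representation

/-! ### Matrices over the free product -/

namespace FreeProd

variable {B : Type u} [Ring B] [Algebra ℂ B] {K : Type y} {X : K → Bimod.{u, w} B}

lemma incl_one (k : K) : incl X k (1, 0) = 1 := by simp [incl]

lemma base_eq_incl (k : K) (b : B) : base X b = incl X k (b, 0) := by simp [incl]

lemma of_eq_incl (k : K) (ξ : (X k).carrier) : of X k ξ = incl X k (0, ξ) := by simp [incl]

/-- Two neighbouring vectors of `X k` multiply to `0`, so only the `B`-component of `ξ` survives,
and it is absorbed into `ζ` by the right action. -/
lemma of_mul_incl (k : K) (ζ : (X k).carrier) (ξ : (X k).Total) :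
    of X k ζ * incl X k ξ = incl X k (0, op ξ.1 • ζ) := by
  simp [incl, mul_add, of_mul_of, of_smul_right]

lemma incl_mul_of (k : K) (ζ : (X k).carrier) (ξ : (X k).Total) :
    incl X k ξ * of X k ζ = incl X k (0, ξ.1 • ζ) := by
  simp [incl, add_mul, of_mul_of, of_smul_left]

/-! `λ_k(T) (ξ ⊗ a) = T ξ ⊗ a` for `a` in `F_k`, and the mirror image for `ρ_k`. -/

lemma leftReg_incl {k : K} (T : (X k).leftOps) (ξ : (X k).Total) :
    leftReg X k T (incl X k ξ) = incl X k (T.1 ξ) := by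
  -- On the summand `B` the factor `L_b` is absorbed into `T`, and `T L_b` sends the vacuum to `T
  -- (b, 0)`.
  have h : leftReg X k T (base X ξ.1) = incl X k (T.1 (ξ.1, 0)) := by
    rw [← mul_one (base X ξ.1), leftReg_base_mul, leftReg_one]
    simp
  have e : ξ = (ξ.1, 0) + (0, ξ.2) := by simp
  rw [e, map_add, ← base_eq_incl, ← of_eq_incl, map_add, h, leftReg_of, map_add, map_add]

lemma leftReg_incl_mul {j k : K} (hj : j ≠ k) (T : (X k).leftOps) (ξ : (X k).Total)
    (η : (X j).carrier) (a : FreeProd X) :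
    leftReg X k T (incl X k ξ * (of X j η * a)) = incl X k (T.1 ξ) * (of X j η * a) := by
  have h : leftReg X k T (base X ξ.1 * (of X j η * a)) =
      incl X k (T.1 (ξ.1, 0)) * (of X j η * a) := by
    rw [leftReg_base_mul, leftReg_of_mul_of_ne hj]
    simp
  have e : ξ = (ξ.1, 0) + (0, ξ.2) := by simp
  rw [e, map_add, ← base_eq_incl, ← of_eq_incl, add_mul, map_add, h, leftReg_of_mul_of_mul hj,
    map_add, map_add, add_mul]

lemma rightReg_incl {k : K} (T : (X k).rightOps) (ξ : (X k).Total) :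
    rightReg X k T (incl X k ξ) = incl X k (T.1 ξ) := by
  have h : rightReg X k T (base X ξ.1) = incl X k (T.1 (ξ.1, 0)) := by
    rw [← one_mul (base X ξ.1), rightReg_mul_base, rightReg_one]
    simp
  have e : ξ = (ξ.1, 0) + (0, ξ.2) := by simp
  rw [e, map_add, ← base_eq_incl, ← of_eq_incl, map_add, h, rightReg_of, map_add, map_add]

lemma rightReg_mul_incl {j k : K} (hj : j ≠ k) (T : (X k).rightOps) (ξ : (X k).Total)
    (η : (X j).carrier) (a : FreeProd X) :
    rightReg X k T (a * of X j η * incl X k ξ) = a * of X j η * incl X k (T.1 ξ) := by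
  have h : rightReg X k T (a * of X j η * base X ξ.1) =
      a * of X j η * incl X k (T.1 (ξ.1, 0)) := by
    rw [rightReg_mul_base, rightReg_mul_of_of_ne hj]
    simp
  have e : ξ = (ξ.1, 0) + (0, ξ.2) := by simp
  rw [e, map_add, ← base_eq_incl, ← of_eq_incl, mul_add, map_add, h, rightReg_mul_of_mul_of hj,
    map_add, map_add, mul_add]

/-- The free product is `(B ⊕ X k) ⊗_B F_k`. -/
lemma left_induction (k : K) {motive : FreeProd X → Prop}
    (incl : ∀ ξ, motive (incl X k ξ))
    (incl_mul : ∀ ξ j (η : (X j).carrier) a, j ≠ k →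
      motive (FreeProd.incl X k ξ * (of X j η * a)))
    (add : ∀ a b, motive a → motive b → motive (a + b)) (a : FreeProd X) : motive a := by
  let S : Set (FreeProd X) := {s | (∃ ξ, s = FreeProd.incl X k ξ) ∨
    ∃ ξ j, ∃ η : (X j).carrier, ∃ c, j ≠ k ∧ s = FreeProd.incl X k ξ * (of X j η * c)}
  -- The sums of elements of `S` form a left ideal; since it contains `1`, it is everything.
  have key : ∀ s ∈ AddSubmonoid.closure S, a * s ∈ AddSubmonoid.closure S := by
    induction a using FreeProd.induction with
    | base b =>
      intro s hs
      induction hs using AddSubmonoid.closure_induction with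
      | mem s hs =>
        refine AddSubmonoid.subset_closure ?_
        rcases hs with ⟨ξ, rfl⟩ | ⟨ξ, j, η, c, hj, rfl⟩
        · exact Or.inl ⟨b • ξ, (incl_smul_left k b ξ).symm⟩
        · exact Or.inr ⟨b • ξ, j, η, c, hj, by rw [incl_smul_left, mul_assoc]⟩
      | zero => rw [mul_zero]; exact zero_mem _
      | add s s' _ _ h h' => rw [mul_add]; exact add_mem h h'
    | of i ζ =>
      intro s hs
      induction hs using AddSubmonoid.closure_induction with
      | mem s hs =>
        refine AddSubmonoid.subset_closure ?_
        by_cases hi : i = k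
        · subst hi
          rcases hs with ⟨ξ, rfl⟩ | ⟨ξ, j, η, c, hj, rfl⟩
          · exact Or.inl ⟨_, of_mul_incl i ζ ξ⟩
          · exact Or.inr ⟨_, j, η, c, hj, by rw [← mul_assoc, of_mul_incl]⟩
        -- A vector of another bimodule starts a new tensor: the `B ⊕ X k` factor is the vacuum, and
        -- all of `s`, whatever its form, is the tail.
        · exact Or.inr ⟨(1, 0), i, ζ, s, hi, by rw [incl_one, one_mul]⟩
      | zero => rw [mul_zero]; exact zero_mem _
      | add s s' _ _ h h' => rw [mul_add]; exact add_mem h h'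
    | mul a b ha hb => intro s hs; rw [mul_assoc]; exact ha _ (hb s hs)
    | add a b ha hb => intro s hs; rw [add_mul]; exact add_mem (ha s hs) (hb s hs)
  have h1 := key 1 (AddSubmonoid.subset_closure (Or.inl ⟨(1, 0), (incl_one k).symm⟩))
  rw [mul_one] at h1
  clear key
  induction h1 using AddSubmonoid.closure_induction with
  | mem s hs =>
    rcases hs with ⟨ξ, rfl⟩ | ⟨ξ, j, η, c, hj, rfl⟩
    · exact incl ξ
    · exact incl_mul ξ j η c hj
  | zero => simpa using incl 0
  | add s s' _ _ h h' => exact add s s' h h'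

/-- The free product is `F_k' ⊗_B (B ⊕ X k)`. -/
lemma right_induction (k : K) {motive : FreeProd X → Prop}
    (incl : ∀ ξ, motive (incl X k ξ))
    (mul_incl : ∀ ξ j (η : (X j).carrier) a, j ≠ k →
      motive (a * of X j η * FreeProd.incl X k ξ))
    (add : ∀ a b, motive a → motive b → motive (a + b)) (a : FreeProd X) : motive a := by
  let S : Set (FreeProd X) := {s | (∃ ξ, s = FreeProd.incl X k ξ) ∨
    ∃ ξ j, ∃ η : (X j).carrier, ∃ c, j ≠ k ∧ s = c * of X j η * FreeProd.incl X k ξ}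
  -- The mirror image: the sums of elements of `S` form a right ideal containing `1`.
  have key : ∀ s ∈ AddSubmonoid.closure S, s * a ∈ AddSubmonoid.closure S := by
    induction a using FreeProd.induction with
    | base b =>
      intro s hs
      induction hs using AddSubmonoid.closure_induction with
      | mem s hs =>
        refine AddSubmonoid.subset_closure ?_
        rcases hs with ⟨ξ, rfl⟩ | ⟨ξ, j, η, c, hj, rfl⟩
        · exact Or.inl ⟨op b • ξ, (incl_smul_right k (op b) ξ).symm⟩
        · exact Or.inr ⟨op b • ξ, j, η, c, hj, by
            rw [incl_smul_right, unop_op, mul_assoc]⟩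
      | zero => rw [zero_mul]; exact zero_mem _
      | add s s' _ _ h h' => rw [add_mul]; exact add_mem h h'
    | of i ζ =>
      intro s hs
      induction hs using AddSubmonoid.closure_induction with
      | mem s hs =>
        refine AddSubmonoid.subset_closure ?_
        by_cases hi : i = k
        · subst hi
          rcases hs with ⟨ξ, rfl⟩ | ⟨ξ, j, η, c, hj, rfl⟩
          · exact Or.inl ⟨_, incl_mul_of i ζ ξ⟩
          · exact Or.inr ⟨_, j, η, c, hj, by rw [mul_assoc, incl_mul_of]⟩
        · exact Or.inr ⟨(1, 0), i, ζ, s, hi, by rw [incl_one, mul_one]⟩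
      | zero => rw [zero_mul]; exact zero_mem _
      | add s s' _ _ h h' => rw [add_mul]; exact add_mem h h'
    | mul a b ha hb => intro s hs; rw [← mul_assoc]; exact hb _ (ha s hs)
    | add a b ha hb => intro s hs; rw [mul_add]; exact add_mem (ha s hs) (hb s hs)
  have h1 := key 1 (AddSubmonoid.subset_closure (Or.inl ⟨(1, 0), (incl_one k).symm⟩))
  rw [one_mul] at h1
  clear key
  induction h1 using AddSubmonoid.closure_induction with
  | mem s hs =>
    rcases hs with ⟨ξ, rfl⟩ | ⟨ξ, j, η, c, hj, rfl⟩
    · exact incl ξ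
    · exact mul_incl ξ j η c hj
  | zero => simpa using incl 0
  | add s s' _ _ h h' => exact add s s' h h'

variable (X) (n : ℕ)

/-- The homomorphism from the free product of the `M_n(B ⊕ X k)` to the matrices over the free
product of the `B ⊕ X k`. -/
noncomputable def toMatrix :
    FreeProd (fun k => (X k).matrix n) →ₐ[ℂ] Matrix (Fin n) (Fin n) (FreeProd X) :=
  lift (base X).mapMatrix
    (fun k ξ => Matrix.map (show Matrix (Fin n) (Fin n) (X k).carrier from ξ) (of X k))
    (fun k ξ η => Matrix.ext fun i j => map_add (of X k) _ _)
    (fun b k ξ => Matrix.ext fun i j => by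
      change of X k (∑ m : Fin n, b i m • (show Matrix (Fin n) (Fin n) (X k).carrier from ξ) m j) = _
      rw [map_sum, Matrix.mul_apply]
      exact Finset.sum_congr rfl fun m _ => of_smul_left k _ _)
    (fun b k ξ => Matrix.ext fun i j => by
      change of X k (∑ m : Fin n,
        op (b m j) • (show Matrix (Fin n) (Fin n) (X k).carrier from ξ) i m) = _
      rw [map_sum, Matrix.mul_apply]
      exact Finset.sum_congr rfl fun m _ => of_smul_right k _ _)
    -- Each entry of the product of two matrices over the same `X k` is a sum of products of two
    -- vectors of `X k`, all of them `0`.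
    (fun k ξ η => Matrix.ext fun i j => by
      rw [Matrix.mul_apply]
      exact Finset.sum_eq_zero fun m _ => of_mul_of k _ _)

variable {X n}

lemma toMatrix_base (b : Matrix (Fin n) (Fin n) B) (i j : Fin n) :
    toMatrix X n (base _ b) i j = base X (b i j) := by
  rw [toMatrix, lift_base]; rfl

lemma toMatrix_of (k : K) (ξ : ((X k).matrix n).carrier) (i j : Fin n) :
    toMatrix X n (of _ k ξ) i j =
      of X k ((show Matrix (Fin n) (Fin n) (X k).carrier from ξ) i j) := by
  rw [toMatrix, lift_of]; rfl

lemma toMatrix_incl (k : K) (ξ : ((X k).matrix n).Total) (i j : Fin n) :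
    toMatrix X n (incl _ k ξ) i j = incl X k ((X k).entries n ξ i j) := by
  have h : incl (fun k => (X k).matrix n) k ξ = base _ ξ.1 + of _ k ξ.2 := rfl
  rw [h, map_add, Matrix.add_apply, toMatrix_base, toMatrix_of]
  rfl

/-- The vector states are algebra homomorphisms, being the quotients by the ideals that the `X k`
generate, so it is enough to compare them on generators. -/
lemma proj_toMatrix (a : FreeProd fun k => (X k).matrix n) (i j : Fin n) :
    proj X (toMatrix X n a i j) = proj _ a i j := by
  induction a using FreeProd.induction generalizing i j with
  | base b => rw [toMatrix_base]; simp [proj]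
  | of k ξ => rw [toMatrix_of]; simp [proj]
  | mul a b ha hb => simp [Matrix.mul_apply, ha, hb]
  | add a b ha hb => simp [ha, hb]

/-- By linearity the vector may be taken as `ξ ⊗ a` with `ξ` in `M_n(B ⊕ X k)` and `a` either `1` or
beginning with a matrix over another `X l`. The entries of such a product are sums of tensors of the
same shape, so `T` acts on the first factor only, before and after passing to entries; what remains
is to interchange finite sums. -/
lemma toMatrix_leftReg {k : K} (T : Matrix (Fin n) (Fin n) (X k).leftOps)
    (a : FreeProd fun k => (X k).matrix n) (i j : Fin n) :
    toMatrix X n (leftReg _ k ((X k).matrixLeftOps n T) a) i j =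
      ∑ m, leftReg X k (T i m) (toMatrix X n a m j) := by
  induction a using left_induction k with
  | incl ξ =>
    rw [leftReg_incl, toMatrix_incl, Bimod.entries_matrixLeftOps, map_sum]
    simp only [toMatrix_incl, leftReg_incl]
  | incl_mul ξ l η a hl =>
    rw [leftReg_incl_mul hl]
    simp only [map_mul, Matrix.mul_apply, toMatrix_incl, toMatrix_of,
      Bimod.entries_matrixLeftOps, map_sum, Finset.mul_sum, Finset.sum_mul,
      leftReg_incl_mul hl]
    exact (Finset.sum_congr rfl fun _ _ => Finset.sum_comm).trans Finset.sum_comm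
  | add a b ha hb => simp only [map_add, Matrix.add_apply, ha, hb, Finset.sum_add_distrib]

/-- The mirror image: the operators act on the last factor and the sum runs over the column index.
-/
lemma toMatrix_rightReg {k : K} (T : (Matrix (Fin n) (Fin n) (X k).rightOpsᵐᵒᵖ)ᵐᵒᵖ)
    (a : FreeProd fun k => (X k).matrix n) (i j : Fin n) :
    toMatrix X n (rightReg _ k ((X k).matrixRightOps n T) a) i j =
      ∑ m, rightReg X k (T.unop m j).unop (toMatrix X n a i m) := by
  induction a using right_induction k with
  | incl ξ =>
    rw [rightReg_incl, toMatrix_incl, Bimod.entries_matrixRightOps, map_sum]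
    simp only [toMatrix_incl, rightReg_incl]
  | mul_incl ξ l η a hl =>
    rw [rightReg_mul_incl hl]
    simp only [map_mul, Matrix.mul_apply, toMatrix_incl, toMatrix_of,
      Bimod.entries_matrixRightOps, map_sum, Finset.mul_sum, Finset.sum_mul,
      rightReg_mul_incl hl]
    exact Finset.sum_comm
  | add a b ha hb => simp only [map_add, Matrix.add_apply, ha, hb, Finset.sum_add_distrib]

end FreeProd

/-! ### Words of matrices -/

section MatrixWords

variable {K : Type y} {C : K → Type z} {D : K → Type t} {n : ℕ}

/-- The letters whose elements are matrices. -/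
abbrev MatrixLetter (C : K → Type z) (D : K → Type t) (n : ℕ) :=
  Letter (fun k => Matrix (Fin n) (Fin n) (C k))
    (fun k => (Matrix (Fin n) (Fin n) (D k)ᵐᵒᵖ)ᵐᵒᵖ)

/-- The action of a matrix letter on matrices over `V`, for a given action of the letters on `V`:
a left letter acts by `[ξ_ij] ↦ [∑ m, Z_im ξ_mj]`, a right letter by
`[ξ_ij] ↦ [∑ m, Z_mj ξ_im]`. -/
def MatrixLetter.act {V : Type*} [AddCommMonoid V] (π : Letter C D → V → V) :
    MatrixLetter C D n → Matrix (Fin n) (Fin n) V → Matrix (Fin n) (Fin n) V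
  | ⟨k, Sum.inl Z⟩, ξ => Matrix.of fun i j => ∑ m, π ⟨k, Sum.inl (Z i m)⟩ (ξ m j)
  | ⟨k, Sum.inr Z⟩, ξ => Matrix.of fun i j => ∑ m, π ⟨k, Sum.inr (Z.unop m j).unop⟩ (ξ i m)

/-- The rule for matrix letters uses only sums and the action of single letters, so it is natural in
additive maps that intertwine the letters. -/
lemma MatrixLetter.act_map {V V' : Type*} [AddCommMonoid V] [AddCommMonoid V']
    {π : Letter C D → V → V} {π' : Letter C D → V' → V'} (g : V →+ V')
    (h : ∀ L ξ, g (π L ξ) = π' L (g ξ)) (L : MatrixLetter C D n) (ξ : Matrix (Fin n) (Fin n) V) :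
    act π' L (ξ.map g) = (act π L ξ).map g := by
  refine Matrix.ext fun i j => ?_
  rcases L with ⟨k, Z | Z⟩ <;> simp [act, h]

/-- The matrix of noncommutative polynomials in the letters that a word of matrices expands to. -/
noncomputable def matrixWord (W : List (MatrixLetter C D n)) :
    Matrix (Fin n) (Fin n) (FreeAlgebra ℂ (Letter C D)) :=
  W.foldr (MatrixLetter.act fun L a => FreeAlgebra.ι ℂ L * a) 1

lemma matrixWord_cons (L : MatrixLetter C D n) (W : List (MatrixLetter C D n)) :
    matrixWord (L :: W) =
      MatrixLetter.act (fun L a => FreeAlgebra.ι ℂ L * a) L (matrixWord W) := rfl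

/-- A word of matrices acts through its expansion. -/
lemma apply_prod_eq_matrixWord {V M : Type*} [AddCommGroup V] [Module ℂ V] [AddCommGroup M]
    [Module ℂ M] (π : Letter C D → Module.End ℂ V) (ρ : MatrixLetter C D n → Module.End ℂ M)
    (e : M → Matrix (Fin n) (Fin n) V)
    (he : ∀ L x, e (ρ L x) = MatrixLetter.act (fun L => π L) L (e x)) {x : M} {v : V}
    (hx : ∀ i j, e x i j = if i = j then v else 0) (W : List (MatrixLetter C D n)) (i j : Fin n) :
    e ((W.map ρ).prod x) i j = FreeAlgebra.lift ℂ π (matrixWord W i j) v := by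
  -- Evaluation of a polynomial at the vector `v`. It intertwines multiplication by a letter with
  -- the action of that letter, so the expansion can be transported along it.
  let g : FreeAlgebra ℂ (Letter C D) →+ V :=
    ((LinearMap.applyₗ v).comp (FreeAlgebra.lift ℂ π).toLinearMap).toAddMonoidHom
  have hg (a) : g a = FreeAlgebra.lift ℂ π a v := rfl
  suffices e ((W.map ρ).prod x) = (matrixWord W).map g by rw [this]; rfl
  induction W with
  | nil =>
    refine Matrix.ext fun i j => ?_
    rw [Matrix.map_apply, matrixWord, List.foldr_nil, Matrix.one_apply]
    split_ifs with h <;> simp [hg, hx, h]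
  | cons L W ih =>
    rw [List.map_cons, List.prod_cons, Module.End.mul_apply, he, ih,
      matrixWord_cons]
    exact MatrixLetter.act_map (π := fun L a => FreeAlgebra.ι ℂ L * a) (π' := fun L => π L) g
      (fun L a => by simp [hg]) L (matrixWord W)

/-- Linear maps on the free algebra that agree on words are equal. -/
lemma freeAlgebra_linearMap_ext {S : Type*} {M : Type*} [AddCommGroup M] [Module ℂ M]
    {f g : FreeAlgebra ℂ S →ₗ[ℂ] M}
    (h : ∀ W : List S, f (W.map (FreeAlgebra.ι ℂ)).prod = g (W.map (FreeAlgebra.ι ℂ)).prod) :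
    f = g := by
  refine LinearMap.ext_on
    -- The words form the submonoid generated by the letters, and they span the free algebra.
    (s := (Submonoid.closure (Set.range (FreeAlgebra.ι ℂ (X := S))) : Set _)) ?_ ?_
  · rw [← Algebra.adjoin_eq_span, FreeAlgebra.adjoin_range_ι, Algebra.top_toSubmodule]
  · intro a ha
    obtain ⟨l, hl, rfl⟩ := Submonoid.exists_list_of_mem_closure ha
    obtain ⟨W, rfl⟩ : l ∈ Set.range (List.map (FreeAlgebra.ι ℂ)) := by
      rw [Set.range_list_map]; exact hl
    exact h W

end MatrixWords

/-! ### The two actions of the matrix letters -/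

section

variable {B : Type u} [Ring B] [Algebra ℂ B] {K : Type y}

/-- This and `Representation.entries_val` put the two sides of the moment identity into the common
form that `apply_prod_eq_matrixWord` takes. -/
lemma toMatrix_toEnd {X : K → Bimod.{u, w} B} {C : K → Type z} {D : K → Type t}
    [∀ k, Ring (C k)] [∀ k, Algebra ℂ (C k)] [∀ k, Ring (D k)] [∀ k, Algebra ℂ (D k)]
    (l : ∀ k, C k →ₐ[ℂ] (X k).leftOps) (r : ∀ k, D k →ₐ[ℂ] (X k).rightOps) (n : ℕ)
    (L : MatrixLetter C D n) (a : FreeProd fun k => (X k).matrix n) :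
    FreeProd.toMatrix X n (Letter.toEnd
        (fun k => ((X k).matrixLeftOps n).comp (l k).mapMatrix)
        (fun k => ((X k).matrixRightOps n).comp (AlgHom.op (AlgHom.op (r k)).mapMatrix)) L a) =
      MatrixLetter.act (fun L => Letter.toEnd l r L) L (FreeProd.toMatrix X n a) := by
  refine Matrix.ext fun i j => ?_
  rcases L with ⟨k, Z | Z⟩
  · exact FreeProd.toMatrix_leftReg ((l k).mapMatrix Z) a i j
  · exact FreeProd.toMatrix_rightReg (AlgHom.op (AlgHom.op (r k)).mapMatrix Z) a i j

variable {A : Type v} [Ring A] [Algebra ℂ A] {P : NCPS B A}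

lemma Representation.entries_val (ϑ : Representation.{u, v, x} P) (n : ℕ)
    (C D : K → Subalgebra ℂ A)
    (L : MatrixLetter (fun k => C k) (fun k => D k) n) (ξ : (ϑ.X₀.matrix n).Total) :
    ϑ.X₀.entries n (Letter.val (fun k => ϑ.matrixLeftFace n (C k))
        (fun k => ϑ.matrixRightFace n (D k)) L ξ) =
      MatrixLetter.act (fun L => ϑ.θ (Letter.val (fun k => (C k).val) (fun k => (D k).val) L)) L
        (ϑ.X₀.entries n ξ) := by
  rcases L with ⟨k, Z | Z⟩ <;> rfl

end

end BiFreeProb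

theorem mainTheorem1 {B : Type u} {A : Type v} [Ring B] [Algebra ℂ B]
    [Ring A] [Algebra ℂ A] (P : BiFreeProb.NCPS B A) {K : Type y} (C D : K → Subalgebra ℂ A)
    (hCD : BiFreeProb.IsBiFree.{w} P (fun k => (C k).val) (fun k => (D k).val))
    (ϑ : BiFreeProb.Representation.{u, v, x} P) (n : ℕ) :
    BiFreeProb.IsBiFree.{w} (ϑ.X₀.matrix n).ncps
      (fun k => ϑ.matrixLeftFace n (C k)) (fun k => ϑ.matrixRightFace n (D k)) := by
  open BiFreeProb MulOpposite in
  obtain ⟨hfaces, X, l, r, hW⟩ := hCD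
  refine ⟨fun k => ϑ.isPairOfFaces_matrix n
      (by simpa only [Subalgebra.range_val] using hfaces k),
    fun k => (X k).matrix n, fun k => ((X k).matrixLeftOps n).comp (l k).mapMatrix,
    fun k => ((X k).matrixRightOps n).comp (AlgHom.op (AlgHom.op (r k)).mapMatrix),
    fun W => Matrix.ext fun i j => ?_⟩
  let π₁ : Letter (fun k => C k) (fun k => D k) → Module.End ℂ ϑ.X₀.Total :=
    fun L => ϑ.θ (Letter.val (fun k => (C k).val) (fun k => (D k).val) L)
  -- Two linear functionals on polynomials in the letters: the expectation in the given
  -- representation and the vacuum expectation on the free product. On words their equality is the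
  -- assumed bi-freeness, as `θ` preserves expectations.
  have key : ϑ.X₀.expectation ∘ₗ (FreeAlgebra.lift ℂ π₁).toLinearMap =
      (FreeProd.proj X).toLinearMap ∘ₗ LinearMap.applyₗ 1 ∘ₗ
        (FreeAlgebra.lift ℂ (Letter.toEnd l r)).toLinearMap := by
    refine freeAlgebra_linearMap_ext fun V => ?_
    have h₁ : FreeAlgebra.lift ℂ π₁ (V.map (FreeAlgebra.ι ℂ)).prod =
        ϑ.θ (V.map (Letter.val (fun k => (C k).val) (fun k => (D k).val))).prod := by
      simp [map_list_prod, Function.comp_def, π₁]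
    have h₂ : FreeAlgebra.lift ℂ (Letter.toEnd l r) (V.map (FreeAlgebra.ι ℂ)).prod =
        (V.map (Letter.toEnd l r)).prod := by
      simp [map_list_prod, Function.comp_def]
    change ϑ.X₀.expectation (FreeAlgebra.lift ℂ π₁ _) =
      FreeProd.expectation X (FreeAlgebra.lift ℂ (Letter.toEnd l r) _)
    rw [h₁, h₂, ϑ.expectation_θ, hW]
  have hl := apply_prod_eq_matrixWord π₁ _ (ϑ.X₀.entries n) (ϑ.entries_val n C D)
    (ϑ.X₀.entries_one n) W i j
  have hr := apply_prod_eq_matrixWord (Letter.toEnd l r) _ (FreeProd.toMatrix X n)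
    (toMatrix_toEnd l r n) (x := 1) (v := 1) (fun i j => by rw [map_one, Matrix.one_apply]) W i j
  -- Both moments in entry `(i, j)` are values of these functionals at the polynomial `matrixWord W
  -- i j`.
  refine (congrArg Prod.fst hl).trans ((LinearMap.congr_fun key _).trans ?_)
  exact (congrArg (FreeProd.proj X) hr).symm.trans (FreeProd.proj_toMatrix _ i j)
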